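/- Let $\mathfrak g=\mathfrak{osp}(1|2)$ be the real Lie superalgebra with basis $H,X,Y$ (even), $A,B$ (odd), whose bracket is graded antisymmetric, $[U,V]=-(-1)^{UV}[V,U]$ (in exponents a homogeneous element stands for its parity), and is given by $$\begin{array}{lll} [H,X]=X, & [H,Y]=-Y, & [X,Y]=2H,\\ {}[H,A]=\tfrac12A, & [X,A]=0, & [Y,A]=-B,\\ {}[H,B]=-\tfrac12B, & [X,B]=-A, & [Y,B]=0,\\ {}[A,A]=2X, & [A,B]=2H, & [B,B]=-2Y. \end{array}$$ Its even part $\mathfrak g_0=\mathrm{Span}(H,X,Y)$ is the Lie algebra $\mathfrak{sl}(2)$. Let $M=M_0\oplus M_1$ be a complex $\mathbb Z_2$-graded $\mathfrak{osp}(1|2)$-module ($\mathfrak g$ acting by $\mathbb C$-linear operators) such that * $M=\bigoplus_{\alpha\in\mathbb C}M^\alpha$, where $M^\alpha=\{v\in M: Hv=\alpha v\}$; * $A:M\to M$ is surjective. For $\mathfrak h=\mathfrak{osp}(1|2)$ or $\mathfrak h=\mathfrak{sl}(2)$ and $n\ge 0$, let $C^n(\mathfrak h,M)$ be the space of real $n$-linear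 maps $f:\mathfrak h^n\to M$ that are graded antisymmetric, that is, $f(\dots,U,V,\dots)=-(-1)^{UV}f(\dots,V,U,\dots)$ for neighbouring homogeneous arguments $U,V$. The cochain $f$ is homogeneous of parity $f\in\mathbb Z_2$ if $f(\mathfrak h_{i_1}\times\dots\times\mathfrak h_{i_n})\subset M_{f+\sum_j i_j}$; every cochain is the sum of its two homogeneous components. The coboundary operator $\partial:C^n(\mathfrak h,M)\to C^{n+1}(\mathfrak h,M)$ is the linear map given, for homogeneous $f$ and homogeneous $U_0,\dots,U_n$, by $$\begin{aligned} (\partial f)(U_0,\dots,U_n)&=\sum_{i=0}^n(-1)^i(-1)^{U_i(f+U_0+\dots+U_{i-1})}\,U_i\,f(U_0,\dots,\widehat{U_i},\dots,U_n)\\ &\quad+\sum_{0\le i<j\le n}(-1)^{i+j}(-1)^{U_i(U_0+\dots+U_{i-1})}(-1)^{U_j(U_0+\dots+\widehat{U_i}+\dots+U_{j-1})}f([U_i,U_j],U_0,\dots,\widehat{U_i},\dots,\widehat{U_j},\dots,U_n). \end{aligned}$$ Put $Z^n=\ker(\partial|_{C^n})$ (cocycles), $B^n=\partial(C^{n-1})$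 (coboundaries), $B^0=0$, and $\mathrm H^n(\mathfrak h,M)=Z^n/B^n$. **Proposition.** For every $n\ge0$, an $n$-cocycle $f\in Z^n(\mathfrak{osp}(1|2),M)$ is a coboundary if and only if its restriction $f|_{\mathfrak{sl}(2)^n}$ is an $\mathfrak{sl}(2)$-coboundary. Equivalently, the map $\varphi:\mathrm H^n(\mathfrak{osp}(1|2),M)\to\mathrm H^n(\mathfrak{sl}(2),M)$ induced by restriction of cocycles is injective. -/

import Mathlib

noncomputable section

namespace SuperCoh

/-! ### Superspaces (`ℤ/2`-graded vector spaces) -/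

/-- A `ℤ/2`-grading `V = V₀ ⊕ V₁` of an `R`-module. -/
class Superspace (R V : Type*) [Ring R] [AddCommGroup V] [Module R V] where
  /-- the homogeneous components; `gr 0` is the even part, `gr 1` the odd part -/
  gr : ZMod 2 → Submodule R V
  isCompl : IsCompl (gr 0) (gr 1)

section superspace

variable (R : Type*) {V : Type*} [Ring R] [AddCommGroup V] [Module R V] [Superspace R V]

/-- `V_p`, the subspace of elements that are homogeneous of parity `p`. -/
abbrev gr (p : ZMod 2) : Submodule R V := Superspace.gr p

theorem isCompl_gr (p : ZMod 2) : IsCompl (gr R p : Submodule R V) (gr R (p + 1)) := by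
  have h := Superspace.isCompl (R := R) (V := V)
  fin_cases p
  · exact h
  · exact h.symm

/-- The projection of `V` onto `V_p` along `V_{p+1}`. -/
def proj (p : ZMod 2) : V →ₗ[R] V :=
  Submodule.projection (gr R p) (gr R (p + 1)) (isCompl_gr R p)

theorem proj_mem (p : ZMod 2) (v : V) : proj R p v ∈ (gr R p : Submodule R V) :=
  Submodule.projection_apply_mem _ _

theorem proj_of_mem {p : ZMod 2} {v : V} (hv : v ∈ (gr R p : Submodule R V)) :
    proj R p v = v :=
  Submodule.projection_apply_of_mem_left _ hv

theorem proj_of_mem_of_ne {p q : ZMod 2} (h : p ≠ q) {v : V}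
    (hv : v ∈ (gr R q : Submodule R V)) : proj R p v = 0 := by
  have hq : q = p + 1 := by
    have key : ∀ p q : ZMod 2, p ≠ q → q = p + 1 := by decide
    exact key p q h
  subst hq
  exact Submodule.projection_apply_of_mem_right _ hv

end superspace

/-! ### Lie superalgebras and their modules -/

/-- A real Lie superalgebra; the sign `(-1)^x` for `x : ZMod 2` is `(-1 : ℤˣ) ^ x`. -/
class LieSuperalgebra (L : Type*) [AddCommGroup L] [Module ℝ L] extends Superspace ℝ L where
  /-- the bracket `[u, v]` -/
  br : L →ₗ[ℝ] L →ₗ[ℝ] L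
  br_mem : ∀ {p q : ZMod 2} {u v : L}, u ∈ gr p → v ∈ gr q → br u v ∈ gr (p + q)
  br_antisymm : ∀ {p q : ZMod 2} {u v : L}, u ∈ gr p → v ∈ gr q →
    br u v = -((-1 : ℤˣ) ^ (p * q) • br v u)
  br_jacobi : ∀ {p q r : ZMod 2} {u v w : L}, u ∈ gr p → v ∈ gr q → w ∈ gr r →
    (-1 : ℤˣ) ^ (p * r) • br (br u v) w + (-1 : ℤˣ) ^ (q * p) • br (br v w) u
      + (-1 : ℤˣ) ^ (r * q) • br (br w u) v = 0

/-- A complex module `M = M₀ ⊕ M₁` over a real Lie superalgebra `L`: the action is `ℝ`-linear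
in `L`, by `ℂ`-linear operators on `M`. -/
class LieSupermodule (L M : Type*) [AddCommGroup L] [Module ℝ L] [LieSuperalgebra L]
    [AddCommGroup M] [Module ℂ M] [Superspace ℂ M] where
  /-- the operator by which an element of `L` acts on `M` -/
  act : L →ₗ[ℝ] Module.End ℂ M
  act_mem : ∀ {p q : ZMod 2} {u : L} {m : M}, u ∈ gr ℝ p → m ∈ gr ℂ q →
    act u m ∈ gr ℂ (p + q)
  act_br : ∀ {p q : ZMod 2} {u v : L}, u ∈ gr ℝ p → v ∈ gr ℝ q → ∀ m : M,
    act (LieSuperalgebra.br u v) m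
      = act u (act v m) - (-1 : ℤˣ) ^ (p * q) • act v (act u m)

open LieSuperalgebra LieSupermodule

/-! ### Cochains and the coboundary operator -/

section cochains

set_option linter.unusedSectionVars false

variable (L M : Type*) [AddCommGroup L] [Module ℝ L] [LieSuperalgebra L]
  [AddCommGroup M] [Module ℂ M] [Superspace ℂ M]

/-- The `n`-linear maps `Lⁿ → M`, a complex vector space. -/
abbrev Mult (n : ℕ) := MultilinearMap ℝ (fun _ : Fin n => L) M

/-- The space `Cⁿ(L, M)` of `n`-cochains: the `n`-linear maps that are graded antisymmetric, i.e.
`f(…, u, v, …) = -(-1)^{uv} f(…, v, u, …)` for neighbouring homogeneous arguments `u`, `v`. -/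
def cochains (n : ℕ) : Submodule ℂ (Mult L M n) where
  carrier := {f | ∀ (i j : Fin n), (j : ℕ) = (i : ℕ) + 1 → ∀ (p q : ZMod 2) (U : Fin n → L),
    U i ∈ gr ℝ p → U j ∈ gr ℝ q →
      f U = -((-1 : ℤˣ) ^ (p * q) • f (fun k => U (Equiv.swap i j k)))}
  zero_mem' := by
    intro i j _ p q U _ _
    simp
  add_mem' := by
    intro f g hf hg i j hij p q U hi hj
    rw [add_apply, add_apply, hf i j hij p q U hi hj,
      hg i j hij p q U hi hj, smul_add, neg_add]
  smul_mem' := by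
    intro c f hf i j hij p q U hi hj
    rw [smul_apply, smul_apply, hf i j hij p q U hi hj,
      smul_neg, smul_comm]

variable {L M}

/-- `f` is homogeneous of parity `p`: it maps `L_{d₁} × ⋯ × L_{dₙ}` to `M_{p + d₁ + ⋯ + dₙ}`. -/
def IsHomogeneous {n : ℕ} (p : ZMod 2) (f : Mult L M n) : Prop :=
  ∀ (d : Fin n → ZMod 2) (U : Fin n → L), (∀ k, U k ∈ gr ℝ (d k)) →
    f U ∈ gr ℂ (p + ∑ k, d k)

/-- The component of parity `p` of an `n`-linear map `f`, so that `f = f₀ + f₁`. -/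
def component {n : ℕ} (p : ZMod 2) (f : Mult L M n) : Mult L M n :=
  ∑ d : Fin n → ZMod 2, ((proj ℂ (p + ∑ k, d k)).restrictScalars ℝ).compMultilinearMap
    (f.compLinearMap fun k => proj ℝ (d k))

theorem component_apply {n : ℕ} (p : ZMod 2) (f : Mult L M n) (U : Fin n → L) :
    component p f U = ∑ d : Fin n → ZMod 2,
      proj ℂ (p + ∑ k, d k) (f fun k => proj ℝ (d k) (U k)) := by
  simp [component]

/-- The second sum in the coboundary formula,
`∑_{i<j} (-1)^{i+j} (-1)^{Uᵢ(U₀+⋯+Uᵢ₋₁)} (-1)^{Uⱼ(U₀+⋯î⋯+Uⱼ₋₁)} f([Uᵢ,Uⱼ], U₀, …î…ĵ…, Uₙ)`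
for homogeneous arguments `U k` of parity `d k`. It is empty for `n = 0`. For `n = m + 1`, the
index `i : Fin (m + 1)` stands for its image in `Fin (m + 2)`. -/
def bracketSum : {n : ℕ} → Mult L M n → (Fin (n + 1) → ZMod 2) → (Fin (n + 1) → L) → M
  | 0, _, _, _ => 0
  | m + 1, f, d, U => ∑ i : Fin (m + 1), ∑ j : Fin (m + 2), if i.castSucc < j then
      ((-1 : ℤˣ) ^ ((i : ℕ) + (j : ℕ))
        * (-1 : ℤˣ) ^ (d i.castSucc * ∑ k ∈ Finset.univ.filter (· < i.castSucc), d k)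
        * (-1 : ℤˣ) ^ (d j * ∑ k ∈ Finset.univ.filter (fun k => k < j ∧ k ≠ i.castSucc), d k)) •
        f (Fin.cons (br (U i.castSucc) (U j)) fun k : Fin m => U (j.succAbove (i.succAbove k)))
      else 0

variable [LieSupermodule L M]

/-- The first sum in the coboundary formula,
`∑ᵢ (-1)^i (-1)^{Uᵢ(f+U₀+⋯+Uᵢ₋₁)} Uᵢ f(U₀, …î…, Uₙ)`,
for `f` homogeneous of parity `p` and homogeneous arguments `U k` of parity `d k`. -/
def actionSum {n : ℕ} (p : ZMod 2) (f : Mult L M n) (d : Fin (n + 1) → ZMod 2)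
    (U : Fin (n + 1) → L) : M :=
  ∑ i : Fin (n + 1), ((-1 : ℤˣ) ^ (i : ℕ)
      * (-1 : ℤˣ) ^ (d i * (p + ∑ k ∈ Finset.univ.filter (· < i), d k))) •
    act (U i) (f fun k => U (i.succAbove k))

/-- The value at `U` of the coboundary of `f`: the formula `actionSum + bracketSum` for homogeneous
`f` and `U`, extended to all `f` and `U` by splitting them into homogeneous components. -/
def coboundaryFun {n : ℕ} (f : Mult L M n) (U : Fin (n + 1) → L) : M :=
  ∑ p : ZMod 2, ∑ d : Fin (n + 1) → ZMod 2,
    (actionSum p (component p f) d (fun k => proj ℝ (d k) (U k))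
      + bracketSum (component p f) d (fun k => proj ℝ (d k) (U k)))

theorem exists_bracketSum {n : ℕ} (f : Mult L M n) (d : Fin (n + 1) → ZMod 2) :
    ∃ F : Mult L M (n + 1), ∀ U, F U = bracketSum f d U := by
  cases n with
  | zero => exact ⟨0, fun U => rfl⟩
  | succ m =>
    let T (i : Fin (m + 1)) (j : Fin (m + 2)) : Mult L M (m + 2) :=
      LinearMap.uncurryMid j
        { toFun := fun u => LinearMap.uncurryMid i (f.curryLeft ∘ₗ (br (L := L)).flip u)
          map_add' := by intro u v; ext; simp
          map_smul' := by intro c u; ext; simp }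
    have hT : ∀ i j U, i.castSucc < j → T i j U
        = f (Fin.cons (br (U i.castSucc) (U j))
            fun k : Fin m => U (j.succAbove (i.succAbove k))) := by
      intro i j U hij
      have h : j.succAbove i = i.castSucc := Fin.succAbove_of_castSucc_lt j i hij
      simp only [T, LinearMap.uncurryMid_apply, LinearMap.coe_mk, AddHom.coe_mk,
        LinearMap.comp_apply, LinearMap.flip_apply, MultilinearMap.curryLeft_apply,
        Fin.removeNth, h]
      rfl
    refine ⟨∑ i : Fin (m + 1), ∑ j : Fin (m + 2), if i.castSucc < j then
      ((-1 : ℤˣ) ^ ((i : ℕ) + (j : ℕ))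
        * (-1 : ℤˣ) ^ (d i.castSucc * ∑ k ∈ Finset.univ.filter (· < i.castSucc), d k)
        * (-1 : ℤˣ) ^ (d j * ∑ k ∈ Finset.univ.filter (fun k => k < j ∧ k ≠ i.castSucc), d k)) •
        T i j else 0, fun U => ?_⟩
    simp only [bracketSum, sum_apply]
    refine Finset.sum_congr rfl fun i _ => Finset.sum_congr rfl fun j _ => ?_
    split_ifs with hij
    · rw [smul_apply, hT i j U hij]
    · rfl

theorem exists_actionSum {n : ℕ} (p : ZMod 2) (f : Mult L M n) (d : Fin (n + 1) → ZMod 2) :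
    ∃ F : Mult L M (n + 1), ∀ U, F U = actionSum p f d U := by
  let T (i : Fin (n + 1)) : Mult L M (n + 1) :=
    LinearMap.uncurryMid i
      { toFun := fun u => ((act u : Module.End ℂ M).restrictScalars ℝ).compMultilinearMap f
        map_add' := by intro u v; ext; simp
        map_smul' := by intro c u; ext; simp }
  refine ⟨∑ i : Fin (n + 1), ((-1 : ℤˣ) ^ (i : ℕ)
      * (-1 : ℤˣ) ^ (d i * (p + ∑ k ∈ Finset.univ.filter (· < i), d k))) • T i, fun U => ?_⟩
  simp only [actionSum, sum_apply]
  rfl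

theorem exists_coboundaryFun {n : ℕ} (f : Mult L M n) :
    ∃ F : Mult L M (n + 1), ⇑F = coboundaryFun f := by
  choose A hA using fun p d => exists_actionSum p (component p f) d
  choose B hB using fun p d => exists_bracketSum (component p f) d
  refine ⟨∑ p : ZMod 2, ∑ d : Fin (n + 1) → ZMod 2,
    (A p d + B p d).compLinearMap fun k => proj ℝ (d k), funext fun U => ?_⟩
  simp [coboundaryFun, hA, hB]

variable (L M) in
/-- The coboundary operator `∂`, from `n`-linear to `(n+1)`-linear maps. -/
def coboundary (n : ℕ) : Mult L M n →ₗ[ℂ] Mult L M (n + 1) where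
  toFun f :=
    { toFun := coboundaryFun f
      map_update_add' := by
        obtain ⟨F, hF⟩ := exists_coboundaryFun f
        rw [← hF]
        exact F.map_update_add
      map_update_smul' := by
        obtain ⟨F, hF⟩ := exists_coboundaryFun f
        rw [← hF]
        exact F.map_update_smul }
  map_add' f g := by
    ext U
    have hc : ∀ p, component p (f + g) = component p f + component p g := by
      intro p; ext V
      simp [component_apply, Finset.sum_add_distrib]
    have ha : ∀ p (f g : Mult L M n) d V,
        actionSum p (f + g) d V = actionSum p f d V + actionSum p g d V := by
      intro p f g d V
      simp [actionSum, Finset.sum_add_distrib]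
    have hb : ∀ (f g : Mult L M n) d V,
        bracketSum (f + g) d V = bracketSum f d V + bracketSum g d V := by
      intro f g d V
      cases n with
      | zero => simp [bracketSum]
      | succ m =>
        simp only [bracketSum, ← Finset.sum_add_distrib]
        refine Finset.sum_congr rfl fun i _ => Finset.sum_congr rfl fun j _ => ?_
        split_ifs <;> simp
    change coboundaryFun (f + g) U = coboundaryFun f U + coboundaryFun g U
    simp only [coboundaryFun, hc, ha, hb, ← Finset.sum_add_distrib]
    refine Finset.sum_congr rfl fun p _ => Finset.sum_congr rfl fun d _ => ?_
    abel
  map_smul' c f := by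
    ext U
    have hc : ∀ p, component p (c • f) = c • component p f := by
      intro p; ext V
      simp [component_apply, Finset.smul_sum]
    have ha : ∀ p (f : Mult L M n) d V, actionSum p (c • f) d V = c • actionSum p f d V := by
      intro p f d V
      simp only [actionSum, Finset.smul_sum, smul_apply, map_smul]
      exact Finset.sum_congr rfl fun i _ => smul_comm _ _ _
    have hb : ∀ (f : Mult L M n) d V, bracketSum (c • f) d V = c • bracketSum f d V := by
      intro f d V
      cases n with
      | zero => simp [bracketSum]
      | succ m =>
        simp only [bracketSum, Finset.smul_sum]
        refine Finset.sum_congr rfl fun i _ => Finset.sum_congr rfl fun j _ => ?_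
        split_ifs
        · rw [smul_apply, smul_comm]
        · simp
    change coboundaryFun (c • f) U = c • coboundaryFun f U
    simp only [coboundaryFun, hc, ha, hb, ← smul_add, ← Finset.smul_sum]

/-- On homogeneous data, `coboundary` is given by the usual formula. -/
theorem coboundary_apply {n : ℕ} {p : ZMod 2} {f : Mult L M n} (hf : IsHomogeneous p f)
    {d : Fin (n + 1) → ZMod 2} {U : Fin (n + 1) → L} (hU : ∀ k, U k ∈ gr ℝ (d k)) :
    coboundary L M n f U = actionSum p f d U + bracketSum f d U := by
  have key : ∀ {m : ℕ} (e : Fin m → ZMod 2) (V : Fin m → L) (hV : ∀ k, V k ∈ gr ℝ (e k))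
      (e' : Fin m → ZMod 2), e' ≠ e → ∃ k, proj ℝ (e' k) (V k) = 0 := by
    intro m e V hV e' he
    obtain ⟨k, hk⟩ := Function.ne_iff.mp he
    exact ⟨k, proj_of_mem_of_ne ℝ hk (hV k)⟩
  -- the components of a homogeneous map, first on homogeneous arguments
  have hcomp : ∀ q, component q f = if q = p then f else 0 := by
    have hval : ∀ q (e : Fin n → ZMod 2) (V : Fin n → L), (∀ k, V k ∈ gr ℝ (e k)) →
        proj ℂ (q + ∑ k, e k) (f V) = if q = p then f V else 0 := by
      intro q e V hV
      split_ifs with hq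
      · subst hq; exact proj_of_mem ℂ (hf e V hV)
      · exact proj_of_mem_of_ne ℂ (fun h => hq (add_right_cancel h)) (hf e V hV)
    intro q
    ext V
    rw [component_apply, Finset.sum_congr rfl fun e _ =>
      hval q e _ fun k => proj_mem ℝ (e k) (V k)]
    have hsum : ∀ v : L, ∑ r : ZMod 2, proj ℝ r v = v := by
      intro v
      have h := Submodule.projection_add_projection_eq_self (isCompl_gr ℝ (V := L) 0) v
      exact (Fin.sum_univ_two (fun r : ZMod 2 => proj ℝ r v)).trans h
    split_ifs with hq
    · have h2 := f.map_sum (fun k (r : ZMod 2) => proj ℝ r (V k))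
      simp only [hsum] at h2
      exact h2.symm
    · simp
  change coboundaryFun f U = _
  unfold coboundaryFun
  rw [Finset.sum_eq_single p]
  · rw [Finset.sum_eq_single d]
    · have : (fun k => proj ℝ (d k) (U k)) = U := funext fun k => proj_of_mem ℝ (hU k)
      rw [hcomp, if_pos rfl, this]
    · intro e _ he
      obtain ⟨k, hk⟩ := key d U hU e he
      obtain ⟨A, hA⟩ := exists_actionSum p (component p f) e
      obtain ⟨B, hB⟩ := exists_bracketSum (component p f) e
      rw [← hA, ← hB, A.map_coord_zero k hk, B.map_coord_zero k hk, add_zero]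
    · simp
  · intro q _ hq
    refine Finset.sum_eq_zero fun e _ => ?_
    rw [hcomp, if_neg hq]
    have hb : ∀ V, bracketSum (0 : Mult L M n) e V = 0 := by
      intro V
      cases n with
      | zero => rfl
      | succ m => simp [bracketSum]
    rw [hb]
    simp [actionSum]
  · simp

variable (L M) in
/-- `Zⁿ(L, M)`, the `n`-cochains `f` with `∂f = 0`. -/
def cocycles (n : ℕ) : Submodule ℂ (Mult L M n) :=
  cochains L M n ⊓ LinearMap.ker (coboundary L M n)

variable (L M) in
/-- `Bⁿ(L, M) = ∂(Cⁿ⁻¹(L, M))`, with `B⁰ = 0`. -/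
def coboundaries : (n : ℕ) → Submodule ℂ (Mult L M n)
  | 0 => ⊥
  | n + 1 => (cochains L M n).map (coboundary L M n)

variable (L M) in
/-- `Hⁿ(L, M) = Zⁿ(L, M) / Bⁿ(L, M)`. -/
abbrev Cohomology (n : ℕ) : Type _ :=
  cocycles L M n ⧸ (coboundaries L M n).submoduleOf (cocycles L M n)

end cochains

/-! ### The even part, and restriction to it -/

section even

set_option linter.unusedSectionVars false

variable (L M : Type*) [AddCommGroup L] [Module ℝ L] [LieSuperalgebra L]
  [AddCommGroup M] [Module ℂ M] [Superspace ℂ M] [LieSupermodule L M]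

/-- The even subalgebra `L₀`. -/
abbrev EvenPart : Type _ := (gr ℝ 0 : Submodule ℝ L)

/-- `L₀` is a (purely even) Lie superalgebra, that is, a Lie algebra. -/
instance evenLieSuperalgebra : LieSuperalgebra (EvenPart L) where
  gr p := (gr ℝ p).comap (gr ℝ 0 : Submodule ℝ L).subtype
  isCompl := by
    have h := Superspace.isCompl (R := ℝ) (V := L)
    have h0 : (gr ℝ 0).comap (gr ℝ 0 : Submodule ℝ L).subtype = ⊤ := by simp
    have h1 : (gr ℝ 1).comap (gr ℝ 0 : Submodule ℝ L).subtype = ⊥ := by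
      rw [eq_bot_iff]
      intro x hx
      exact Subtype.ext (Submodule.disjoint_def.mp h.disjoint x x.2 hx)
    rw [h0, h1]
    exact isCompl_top_bot
  br := LinearMap.mk₂ ℝ (fun u v => ⟨br (u : L) (v : L), by
      have h := br_mem (L := L) u.2 v.2
      rwa [add_zero] at h⟩)
    (by intros; ext; simp) (by intros; ext; simp) (by intros; ext; simp) (by intros; ext; simp)
  br_mem := by
    intro p q u v hu hv
    exact br_mem (L := L) hu hv
  br_antisymm := by
    intro p q u v hu hv
    ext
    have h := br_antisymm (L := L) hu hv
    rcases Int.units_eq_one_or ((-1 : ℤˣ) ^ (p * q)) with e | e <;> simpa [e] using h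
  br_jacobi := by
    intro p q r u v w hu hv hw
    ext
    have h := br_jacobi (L := L) hu hv hw
    rcases Int.units_eq_one_or ((-1 : ℤˣ) ^ (p * r)) with e1 | e1 <;>
    rcases Int.units_eq_one_or ((-1 : ℤˣ) ^ (q * p)) with e2 | e2 <;>
    rcases Int.units_eq_one_or ((-1 : ℤˣ) ^ (r * q)) with e3 | e3 <;>
    simpa [e1, e2, e3] using h

/-- An `L`-module is an `L₀`-module. -/
instance evenLieSupermodule : LieSupermodule (EvenPart L) M where
  act := act ∘ₗ (gr ℝ 0 : Submodule ℝ L).subtype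
  act_mem := fun {_ _ _ _} hu hm => act_mem (L := L) hu hm
  act_br := fun {_ _ _ _} hu hv m => act_br (L := L) hu hv m

/-- The restriction of an `n`-linear map on `L` to `L₀`. -/
def restrict (n : ℕ) : Mult L M n →ₗ[ℂ] Mult (EvenPart L) M n where
  toFun f := f.compLinearMap fun _ => (gr ℝ 0 : Submodule ℝ L).subtype
  map_add' _ _ := rfl
  map_smul' _ _ := rfl

variable {L M}

theorem restrict_apply {n : ℕ} (f : Mult L M n) (U : Fin n → EvenPart L) :
    restrict L M n f U = f fun k => (U k : L) := rfl

theorem coe_proj_even (p : ZMod 2) (u : EvenPart L) :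
    ((proj ℝ p u : EvenPart L) : L) = proj ℝ p (u : L) := by
  by_cases hp : p = 0
  · subst hp
    rw [proj_of_mem ℝ u.2, proj_of_mem ℝ (show u ∈ (gr ℝ 0 : Submodule ℝ (EvenPart L)) from u.2)]
  · rw [proj_of_mem_of_ne ℝ hp u.2,
      proj_of_mem_of_ne ℝ hp (show u ∈ (gr ℝ 0 : Submodule ℝ (EvenPart L)) from u.2)]
    rfl

theorem component_restrict {n : ℕ} (p : ZMod 2) (f : Mult L M n) :
    component p (restrict L M n f) = restrict L M n (component p f) := by
  ext U
  simp only [restrict_apply, component_apply, coe_proj_even]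

theorem bracketSum_restrict {n : ℕ} (f : Mult L M n) (d : Fin (n + 1) → ZMod 2)
    (U : Fin (n + 1) → EvenPart L) :
    bracketSum (restrict L M n f) d U = bracketSum f d (fun k => (U k : L)) := by
  cases n with
  | zero => rfl
  | succ m =>
    simp only [bracketSum, restrict_apply]
    refine Finset.sum_congr rfl fun i _ => Finset.sum_congr rfl fun j _ => ?_
    split_ifs
    · congr 2
      funext k
      refine Fin.cases rfl (fun k => rfl) k
    · rfl

/-- Restriction commutes with the coboundary operator. -/
theorem coboundary_restrict {n : ℕ} (f : Mult L M n) :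
    coboundary (EvenPart L) M n (restrict L M n f) = restrict L M (n + 1) (coboundary L M n f) := by
  ext U
  change coboundaryFun (restrict L M n f) U = coboundaryFun f (fun k => (U k : L))
  simp only [coboundaryFun, component_restrict, bracketSum_restrict, coe_proj_even]
  refine Finset.sum_congr rfl fun p _ => Finset.sum_congr rfl fun d _ => ?_
  congr 1
  simp only [actionSum, restrict_apply, coe_proj_even]
  refine Finset.sum_congr rfl fun i _ => ?_
  rw [← coe_proj_even]
  rfl

theorem restrict_mem_cochains {n : ℕ} {f : Mult L M n} (hf : f ∈ cochains L M n) :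
    restrict L M n f ∈ cochains (EvenPart L) M n :=
  fun i j hij p q U hi hj => hf i j hij p q (fun k => (U k : L)) hi hj

theorem restrict_mem_cocycles {n : ℕ} {f : Mult L M n} (hf : f ∈ cocycles L M n) :
    restrict L M n f ∈ cocycles (EvenPart L) M n := by
  refine ⟨restrict_mem_cochains hf.1, ?_⟩
  have h : coboundary L M n f = 0 := hf.2
  change coboundary (EvenPart L) M n (restrict L M n f) = 0
  rw [coboundary_restrict, h, map_zero]

theorem restrict_mem_coboundaries {n : ℕ} {f : Mult L M n} (hf : f ∈ coboundaries L M n) :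
    restrict L M n f ∈ coboundaries (EvenPart L) M n := by
  cases n with
  | zero =>
    have h : f = 0 := hf
    rw [h, map_zero]
    exact zero_mem _
  | succ n =>
    obtain ⟨g, hg, rfl⟩ := hf
    exact ⟨restrict L M n g, restrict_mem_cochains hg, coboundary_restrict g⟩

variable (L M)

/-- The map `Hⁿ(L, M) → Hⁿ(L₀, M)` induced by restriction of cocycles. -/
def restrictCohomology (n : ℕ) : Cohomology L M n →ₗ[ℂ] Cohomology (EvenPart L) M n :=
  Submodule.mapQ _ _
    (LinearMap.restrict (restrict L M n) fun _ hf => restrict_mem_cocycles hf)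
    fun _ hf => restrict_mem_coboundaries hf

end even

/-! ### The Lie superalgebra `osp(1|2)` -/

/-- Labels of the basis vectors `H`, `X`, `Y` (even) and `A`, `B` (odd). -/
inductive Gen : Type
  | H | X | Y | A | B
  deriving DecidableEq

instance : Fintype Gen := ⟨{.H, .X, .Y, .A, .B}, by intro x; cases x <;> decide⟩

/-- The parity of a basis vector. -/
def Gen.parity : Gen → ZMod 2
  | .H | .X | .Y => 0
  | .A | .B => 1

/-- The real vector space with basis `H, X, Y, A, B`, in coordinates. -/
def Osp12 : Type := Gen → ℝ

namespace Osp12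

instance : AddCommGroup Osp12 := inferInstanceAs (AddCommGroup (Gen → ℝ))

instance : Module ℝ Osp12 := inferInstanceAs (Module ℝ (Gen → ℝ))

/-- The basis vector with label `s`. -/
def e (s : Gen) : Osp12 := fun t => if t = s then 1 else 0

/-- The brackets of the basis vectors. -/
def brGen : Gen → Gen → Osp12
  | .H, .H => 0
  | .H, .X => e .X
  | .H, .Y => -e .Y
  | .H, .A => (1 / 2 : ℝ) • e .A
  | .H, .B => -((1 / 2 : ℝ) • e .B)
  | .X, .H => -e .X
  | .X, .X => 0
  | .X, .Y => (2 : ℝ) • e .H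
  | .X, .A => 0
  | .X, .B => -e .A
  | .Y, .H => e .Y
  | .Y, .X => -((2 : ℝ) • e .H)
  | .Y, .Y => 0
  | .Y, .A => -e .B
  | .Y, .B => 0
  | .A, .H => -((1 / 2 : ℝ) • e .A)
  | .A, .X => 0
  | .A, .Y => e .B
  | .A, .A => (2 : ℝ) • e .X
  | .A, .B => (2 : ℝ) • e .H
  | .B, .H => (1 / 2 : ℝ) • e .B
  | .B, .X => e .A
  | .B, .Y => 0
  | .B, .A => (2 : ℝ) • e .H
  | .B, .B => -((2 : ℝ) • e .Y)

/-- The bilinear extension of `brGen`. -/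
def bracket : Osp12 →ₗ[ℝ] Osp12 →ₗ[ℝ] Osp12 :=
  LinearMap.mk₂ ℝ (fun u v => ∑ s, ∑ t, (u s * v t) • brGen s t)
    (fun u u' v => by
      simp only [← Finset.sum_add_distrib, ← add_smul, ← add_mul]; rfl)
    (fun c u v => by
      simp only [Finset.smul_sum, smul_smul, ← mul_assoc]; rfl)
    (fun u v v' => by
      simp only [← Finset.sum_add_distrib, ← add_smul, ← mul_add]; rfl)
    (fun c u v => by
      simp only [Finset.smul_sum, smul_smul, mul_left_comm c]; rfl)

theorem bracket_e (s t : Gen) : bracket (e s) (e t) = brGen s t := by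
  simp [bracket, e]

/-- The vectors of parity `p`: the span of the basis vectors of parity `p`. -/
def homog (p : ZMod 2) : Submodule ℝ Osp12 where
  carrier := {u | ∀ s, s.parity ≠ p → u s = 0}
  zero_mem' := fun _ _ => rfl
  add_mem' := by
    intro u v hu hv s hs
    change u s + v s = 0
    rw [hu s hs, hv s hs, add_zero]
  smul_mem' := by
    intro c u hu s hs
    change c * u s = 0
    rw [hu s hs, mul_zero]

theorem isCompl_homog : IsCompl (homog 0) (homog 1) := by
  refine IsCompl.of_eq ?_ ?_
  · refine (Submodule.eq_bot_iff _).mpr fun u hu => funext fun s => ?_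
    by_cases hs : s.parity = 0
    · exact hu.2 s (by rw [hs]; decide)
    · exact hu.1 s hs
  · refine Submodule.eq_top_iff'.mpr fun u => Submodule.mem_sup.mpr
      ⟨fun s => if s.parity = 0 then u s else 0, fun s hs => if_neg hs,
        fun s => if s.parity = 0 then 0 else u s, fun s hs => ?_, funext fun s => ?_⟩
    · exact if_pos (by revert hs; cases s <;> decide)
    · change (if s.parity = 0 then u s else 0) + (if s.parity = 0 then 0 else u s) = u s
      split_ifs <;> simp

theorem mem_homog_zero {u : Osp12} : u ∈ homog 0 ↔ u .A = 0 ∧ u .B = 0 := by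
  refine ⟨fun h => ⟨h .A (by decide), h .B (by decide)⟩, fun h s hs => ?_⟩
  cases s <;> first | exact h.1 | exact h.2 | exact absurd rfl hs

theorem mem_homog_one {u : Osp12} : u ∈ homog 1 ↔ u .H = 0 ∧ u .X = 0 ∧ u .Y = 0 := by
  refine ⟨fun h => ⟨h .H (by decide), h .X (by decide), h .Y (by decide)⟩, fun h s hs => ?_⟩
  cases s <;> first | exact h.1 | exact h.2.1 | exact h.2.2 | exact absurd rfl hs

theorem parity_cases (p : ZMod 2) : p = 0 ∨ p = 1 := by
  revert p; decide

theorem neg_one_uzpow (p : ZMod 2) : (-1 : ℤˣ) ^ p = if p = 0 then 1 else -1 := by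
  revert p; decide

theorem bracket_apply (u v : Osp12) (r : Gen) :
    bracket u v r = match r with
      | .H => 2 * (u .X * v .Y - u .Y * v .X + u .A * v .B + u .B * v .A)
      | .X => u .H * v .X - u .X * v .H + 2 * (u .A * v .A)
      | .Y => u .Y * v .H - u .H * v .Y - 2 * (u .B * v .B)
      | .A => (u .H * v .A - u .A * v .H) / 2 - u .X * v .B + u .B * v .X
      | .B => (u .B * v .H - u .H * v .B) / 2 - u .Y * v .A + u .A * v .Y := by
  have hadd : ∀ (a b : Osp12) t, (a + b) t = a t + b t := fun _ _ _ => rfl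
  have hneg : ∀ (a : Osp12) t, (-a) t = -a t := fun _ _ => rfl
  have hsmul : ∀ (c : ℝ) (a : Osp12) t, (c • a) t = c * a t := fun _ _ _ => rfl
  have hsum : ∀ g : Gen → Osp12, ∑ s, g s = g .H + (g .X + (g .Y + (g .A + g .B))) := by
    intro g
    have : (Finset.univ : Finset Gen) = {.H, .X, .Y, .A, .B} := rfl
    rw [this]
    simp
  cases r <;>
    simp [bracket, hsum, hadd, hneg, hsmul, brGen, e] <;> ring

instance : LieSuperalgebra Osp12 where
  gr := homog
  isCompl := isCompl_homog
  br := bracket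
  br_mem := by
    intro p q u v hu hv
    obtain rfl | rfl := parity_cases p <;> obtain rfl | rfl := parity_cases q <;>
      simp only [add_zero, zero_add, show (1 + 1 : ZMod 2) = 0 from rfl, mem_homog_zero,
        mem_homog_one, bracket_apply] at hu hv ⊢ <;>
      simp [hu, hv]
  br_antisymm := by
    intro p q u v hu hv
    have hneg : ∀ (a : Osp12) t, (-a) t = -a t := fun _ _ => rfl
    obtain rfl | rfl := parity_cases p <;> obtain rfl | rfl := parity_cases q <;>
      simp only [mem_homog_zero, mem_homog_one] at hu hv <;>
      (funext r; simp only [neg_one_uzpow]; cases r) <;>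
      simp [bracket_apply, hneg, hu, hv] <;> ring
  br_jacobi := by
    intro p q r u v w hu hv hw
    have hadd : ∀ (a b : Osp12) t, (a + b) t = a t + b t := fun _ _ _ => rfl
    have hneg : ∀ (a : Osp12) t, (-a) t = -a t := fun _ _ => rfl
    have hzero : ∀ t, (0 : Osp12) t = 0 := fun _ => rfl
    obtain rfl | rfl := parity_cases p <;> obtain rfl | rfl := parity_cases q <;>
      obtain rfl | rfl := parity_cases r <;>
      simp only [mem_homog_zero, mem_homog_one] at hu hv hw <;>
      (funext r; simp only [neg_one_uzpow]; cases r) <;>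
      simp [bracket_apply, hadd, hneg, hzero, hu, hv, hw] <;> ring

end Osp12

/-- The even subalgebra `sl(2) = Span(H, X, Y)` of `osp(1|2)`. -/
abbrev Sl2 : Type := EvenPart Osp12

end SuperCoh

end

/-!
The proof is a computation in the Cartan calculus of the complex `C*(𝔤, M)`, `𝔤 = osp(1|2)`.
Write `i_u` for the insertion of `u` in the first slot and `θ_u` for the Lie derivative. Cartan's
formula `i_u ∂ + ∂ i_u = θ_u` (`contract_coboundary`), together with
`i_v θ_u = (-1)^{uv} θ_u i_v - i_{[u,v]}` (`contract_lieDer`), determines `∂` recursively, and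
everything else (`∂ ∂ = 0`, `∂` preserves graded antisymmetry, commutators of Lie derivatives)
follows by induction on the degree. The operators are then assembled on the space
`TotalCochains` of sequences of cochains, where they can be iterated and composed freely.
As `i_u² = 0` for even `u`, only the powers of `i_A` and `i_B` allow cochains of high degree.

*Degree `≥ 3`: every cocycle is a coboundary.* Since `[A, A] = 2X`, subtracting multiples of
`∂ (X* ∧ i_A² f)` lowers the power of `i_A` that kills a cocycle `f`, down to `i_A² f = 0`
(`exists_elimination`). As `A` is surjective on `M`, so is `X = A²`; a right inverse `T` of `X`
gives the correction `-θ_A (T ∘ i_A f)`, after which `Y* ∧ i_A f = 0` (`exists_normal_A`). The same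
elimination with `[B, B] = -2Y` achieves `i_B² f = 0` without spoiling this normal form
(`normal_preserved`). The cocycle equation then forces `i_A f` and `i_B f` to have degree `≤ 1`,
hence `f` to have degree `≤ 2` (`degreeLE_of_normal`).

*Degree `1` and `2`.* If `f` restricts to `∂ k` on `sl(2)`, extend `k` by zero on the odd part and
subtract the coboundary of the extension: now `f` vanishes on even arguments. An explicit primitive
is then written down (`exists_primitive_one`, `exists_primitive_two`); that it works follows from a
rigidity statement (`degreeLE_zero_of_ι`): a cocycle killed by `i_A i_A`, `i_A i_B`, `i_B i_B`,
`i_H i_A` and `i_H i_B`, and with no `A` or `B` component in degree `1`, vanishes in positive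
degree.

*Degree `0`.* There are no nonzero coboundaries and `C⁰(𝔤, M) = M = C⁰(sl(2), M)`.
-/

noncomputable section

namespace SuperCoh

open LieSuperalgebra LieSupermodule

/-! ### Parity -/

section parity

variable (R : Type*) {V : Type*} [Ring R] [AddCommGroup V] [Module R V] [Superspace R V]

theorem proj_zero_add_proj_one (v : V) : proj R 0 v + proj R 1 v = v :=
  Submodule.projection_add_projection_eq_self (isCompl_gr R (V := V) 0) v

/-- The operator `v ↦ (-1)^{p v} v` for homogeneous `v`: the identity if `p = 0`, and the parity
automorphism of the superspace if `p = 1`. -/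
def parityAut (p : ZMod 2) : V →ₗ[R] V :=
  proj R 0 + (-1 : ℤˣ) ^ p • proj R 1

variable {R}

theorem parityAut_of_mem (p : ZMod 2) {q : ZMod 2} {v : V} (hv : v ∈ (gr R q : Submodule R V)) :
    parityAut R p v = (-1 : ℤˣ) ^ (p * q) • v := by
  obtain rfl | rfl := Osp12.parity_cases q
  · simp [parityAut, proj_of_mem R hv, proj_of_mem_of_ne R (show (1 : ZMod 2) ≠ 0 by decide) hv]
  · simp [parityAut, proj_of_mem R hv, proj_of_mem_of_ne R (show (0 : ZMod 2) ≠ 1 by decide) hv]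

/-- An additive property holds for all vectors once it holds for the homogeneous ones. -/
theorem hom_induction {P : V → Prop} (hadd : ∀ u v, P u → P v → P (u + v))
    (hom : ∀ (p : ZMod 2) (v : V), v ∈ (gr R p : Submodule R V) → P v) (v : V) : P v := by
  rw [← proj_zero_add_proj_one R v]
  exact hadd _ _ (hom 0 _ (proj_mem R 0 v)) (hom 1 _ (proj_mem R 1 v))

end parity

/-! ### Insertions, exterior multiplication and Lie derivatives -/

section calculus

set_option linter.unusedSectionVars false

variable {L M : Type*} [AddCommGroup L] [Module ℝ L] [LieSuperalgebra L]
  [AddCommGroup M] [Module ℂ M] [Superspace ℂ M]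

variable (M) in
/-- The insertion `i_u` of `u` in the first slot of a multilinear map. -/
def contract {n : ℕ} (u : L) : Mult L M (n + 1) →ₗ[ℂ] Mult L M n where
  toFun f := f.curryLeft u
  map_add' _ _ := rfl
  map_smul' _ _ := rfl

@[simp] theorem contract_apply {n : ℕ} (u : L) (f : Mult L M (n + 1)) (V : Fin n → L) :
    contract M u f V = f (Fin.cons u V) := rfl

theorem contract_ext {n : ℕ} {f g : Mult L M (n + 1)} (h : ∀ u, contract M u f = contract M u g) :
    f = g := by
  ext V
  rw [← Fin.cons_self_tail V]
  exact congrArg (fun k : Mult L M n => k (Fin.tail V)) (h (V 0))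

theorem contract_add {n : ℕ} (u v : L) (f : Mult L M (n + 1)) :
    contract M (u + v) f = contract M u f + contract M v f := f.curryLeft.map_add u v

theorem contract_smul {n : ℕ} (c : ℝ) (u : L) (f : Mult L M (n + 1)) :
    contract M (c • u) f = c • contract M u f := f.curryLeft.map_smul c u

theorem contract_neg {n : ℕ} (u : L) (f : Mult L M (n + 1)) :
    contract M (-u) f = -contract M u f := f.curryLeft.map_neg u

theorem contract_unit_smul {n : ℕ} (s : ℤˣ) (u : L) (f : Mult L M (n + 1)) :
    contract M (s • u) f = s • contract M u f := by
  rcases Int.units_eq_one_or s with rfl | rfl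
  · simp
  · simp [contract_neg]

theorem contract_ext_hom {n : ℕ} {f g : Mult L M (n + 1)}
    (h : ∀ (p : ZMod 2) (u : L), u ∈ gr ℝ p → contract M u f = contract M u g) :
    f = g :=
  contract_ext fun u => hom_induction (R := ℝ) (P := fun u => contract M u f = contract M u g)
    (fun u v hu hv => by rw [contract_add, contract_add, hu, hv]) h u

theorem mult_ext_hom {n : ℕ} {f g : Mult L M n}
    (h : ∀ (d : Fin n → ZMod 2) (U : Fin n → L), (∀ k, U k ∈ gr ℝ (d k)) → f U = g U) :
    f = g := by
  induction n with
  | zero => ext U; exact h (fun _ => 0) U (fun k => k.elim0)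
  | succ n ih =>
    refine contract_ext_hom fun p u hu => ih fun d U hU => h (Fin.cons p d) (Fin.cons u U) ?_
    intro k
    refine Fin.cases hu (fun k => ?_) k
    simpa using hU k

theorem contract_uncurryLeft {n : ℕ} (k : L →ₗ[ℝ] Mult L M n) (u : L) :
    contract M u (LinearMap.uncurryLeft k : Mult L M (n + 1)) = k u := by
  ext V
  rw [contract_apply, LinearMap.uncurryLeft_apply, Fin.cons_zero, Fin.tail_cons]

theorem curryLeft_apply' {n : ℕ} (f : Mult L M (n + 1)) (u : L) :
    f.curryLeft u = contract M u f := rfl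

theorem contract_real_smul {n : ℕ} (r : ℝ) (u : L) (f : Mult L M (n + 1)) :
    contract M u (r • f) = r • contract M u f := rfl

theorem mem_cochains_zero (f : Mult L M 0) : f ∈ cochains L M 0 :=
  fun i => i.elim0

theorem mem_cochains_one (f : Mult L M 1) : f ∈ cochains L M 1 := by
  intro i j h
  omega

theorem cons_cons_swap {n : ℕ} (u v : L) (W : Fin n → L) :
    (fun k => (Fin.cons u (Fin.cons v W : Fin (n + 1) → L) : Fin (n + 2) → L)
      (Equiv.swap 0 1 k)) = Fin.cons v (Fin.cons u W) := by
  funext k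
  refine Fin.cases ?_ (fun k => Fin.cases ?_ (fun k => ?_) k) k
  · simp
  · simp [show (Fin.succ 0 : Fin (n + 2)) = 1 from rfl]
  · rw [Equiv.swap_apply_of_ne_of_ne]
    · rfl
    · exact (Fin.succ_ne_zero _)
    · rw [← Fin.succ_zero_eq_one]
      exact fun h => Fin.succ_ne_zero _ (Fin.succ_injective _ h)

theorem cons_swap_succ {n : ℕ} (u : L) (W : Fin n → L) (i j : Fin n) :
    (fun k => (Fin.cons u W : Fin (n + 1) → L) (Equiv.swap i.succ j.succ k))
      = Fin.cons u (fun k => W (Equiv.swap i j k)) := by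
  funext k
  refine Fin.cases ?_ (fun k => ?_) k
  · rw [Equiv.swap_apply_of_ne_of_ne (Fin.succ_ne_zero _).symm (Fin.succ_ne_zero _).symm]
    rfl
  · rw [Function.Injective.swap_apply (Fin.succ_injective n)]
    rfl

theorem contract_mem_cochains {n : ℕ} (u : L) {f : Mult L M (n + 1)}
    (hf : f ∈ cochains L M (n + 1)) : contract M u f ∈ cochains L M n := by
  intro i j hij p q U hi hj
  have h := hf i.succ j.succ (by simp [hij]) p q (Fin.cons u U) (by simpa) (by simpa)
  rw [cons_swap_succ] at h
  exact h

theorem contract_contract {n : ℕ} {p q : ZMod 2} {u v : L} (hu : u ∈ gr ℝ p) (hv : v ∈ gr ℝ q)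
    {f : Mult L M (n + 2)} (hf : f ∈ cochains L M (n + 2)) :
    contract M v (contract M u f) = -((-1 : ℤˣ) ^ (p * q) • contract M u (contract M v f)) := by
  ext W
  have h := hf 0 1 (by simp) p q (Fin.cons u (Fin.cons v W)) hu hv
  rw [cons_cons_swap] at h
  exact h

/-- Graded antisymmetry can be checked on insertions: in the first two slots, and after inserting
one vector. -/
theorem mem_cochains_of_contract {n : ℕ} {f : Mult L M (n + 2)}
    (h1 : ∀ u, contract M u f ∈ cochains L M (n + 1))
    (h2 : ∀ {p q : ZMod 2} {u v : L}, u ∈ gr ℝ p → v ∈ gr ℝ q →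
      contract M v (contract M u f) = -((-1 : ℤˣ) ^ (p * q) • contract M u (contract M v f))) :
    f ∈ cochains L M (n + 2) := by
  intro i j hij p q U hi hj
  obtain ⟨u, U, rfl⟩ : ∃ u U', U = Fin.cons u U' := ⟨U 0, Fin.tail U, (Fin.cons_self_tail U).symm⟩
  obtain ⟨j, rfl⟩ := Fin.exists_succ_eq.mpr (show j ≠ 0 by rintro rfl; simp at hij)
  induction i using Fin.cases with
  | zero =>
    obtain rfl : j = 0 := by ext; simpa using hij
    obtain ⟨v, U, rfl⟩ : ∃ u U', U = Fin.cons u U' :=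
      ⟨U 0, Fin.tail U, (Fin.cons_self_tail U).symm⟩
    rw [show (Fin.succ 0 : Fin (n + 2)) = 1 from rfl, cons_cons_swap]
    exact congrArg (fun k : Mult L M n => k U) (h2 hi hj)
  | succ i =>
    rw [cons_swap_succ]
    exact h1 u i j (by simpa using hij) p q U hi hj

variable (M) in
/-- Left exterior multiplication `φ ∧ ·` by a linear form `φ`, defined by recursion on the degree
through `i_u (φ ∧ f) = φ(u) f - φ ∧ i_u f`. It is the graded antisymmetric product when `φ` vanishes
on odd vectors. -/
def wedge (φ : L →ₗ[ℝ] ℝ) : (n : ℕ) → Mult L M n →ₗ[ℂ] Mult L M (n + 1)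
  | 0 =>
    { toFun := fun f => LinearMap.uncurryLeft (φ.smulRight f)
      map_add' := fun f g => contract_ext fun u => by
        simp only [map_add, contract_uncurryLeft, LinearMap.smulRight_apply, smul_add]
      map_smul' := fun c f => contract_ext fun u => by
        simp only [map_smul, contract_uncurryLeft, LinearMap.smulRight_apply, RingHom.id_apply]
        exact smul_comm _ _ _ }
  | n + 1 =>
    { toFun := fun f => LinearMap.uncurryLeft
        (φ.smulRight f - (wedge φ n).restrictScalars ℝ ∘ₗ f.curryLeft)
      map_add' := fun f g => contract_ext fun u => by
        simp only [map_add, contract_uncurryLeft, LinearMap.smulRight_apply, smul_add,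
          LinearMap.sub_apply, LinearMap.comp_apply, curryLeft_apply',
          LinearMap.restrictScalars_apply]
        abel
      map_smul' := fun c f => contract_ext fun u => by
        simp only [map_smul, contract_uncurryLeft, LinearMap.smulRight_apply, RingHom.id_apply,
          LinearMap.sub_apply, LinearMap.comp_apply, curryLeft_apply',
          LinearMap.restrictScalars_apply, smul_sub]
        rw [smul_comm] }

theorem contract_wedge_zero (φ : L →ₗ[ℝ] ℝ) (u : L) (f : Mult L M 0) :
    contract M u (wedge M φ 0 f) = φ u • f := contract_uncurryLeft _ u

theorem contract_wedge_succ (φ : L →ₗ[ℝ] ℝ) {n : ℕ} (u : L) (f : Mult L M (n + 1)) :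
    contract M u (wedge M φ (n + 1) f) = φ u • f - wedge M φ n (contract M u f) :=
  contract_uncurryLeft _ u

theorem real_smul_mem_cochains {n : ℕ} (r : ℝ) {f : Mult L M n} (hf : f ∈ cochains L M n) :
    r • f ∈ cochains L M n :=
  ((cochains L M n).restrictScalars ℝ).smul_mem r hf

theorem units_smul_mem_cochains {n : ℕ} (s : ℤˣ) {f : Mult L M n} (hf : f ∈ cochains L M n) :
    s • f ∈ cochains L M n := by
  rcases Int.units_eq_one_or s with rfl | rfl
  · rwa [one_smul]
  · rw [Units.neg_smul, one_smul]
    exact neg_mem hf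

theorem wedge_mem_cochains {φ : L →ₗ[ℝ] ℝ} (hφ : ∀ u ∈ (gr ℝ 1 : Submodule ℝ L), φ u = 0) {n : ℕ}
    {f : Mult L M n} (hf : f ∈ cochains L M n) : wedge M φ n f ∈ cochains L M (n + 1) := by
  induction n with
  | zero => exact mem_cochains_one _
  | succ n ih =>
    refine mem_cochains_of_contract (fun u => ?_) fun {p q u v} hu hv => ?_
    · rw [contract_wedge_succ]
      exact sub_mem (real_smul_mem_cochains _ hf) (ih (contract_mem_cochains u hf))
    · have hc : (p = 1 ∧ q = 1) ∨ ((-1 : ℤˣ) ^ (p * q) = 1 ) := by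
        have key : ∀ p q : ZMod 2, (p = 1 ∧ q = 1) ∨ ((-1 : ℤˣ) ^ (p * q) = 1) := by decide
        exact key p q
      rw [contract_wedge_succ, contract_wedge_succ, map_sub, map_sub, contract_real_smul,
        contract_real_smul]
      cases n with
      | zero =>
        rw [contract_wedge_zero, contract_wedge_zero]
        rcases hc with ⟨rfl, rfl⟩ | h
        · simp [hφ u hu, hφ v hv]
        · rw [h, one_smul, neg_sub]
      | succ n =>
        rw [contract_wedge_succ, contract_wedge_succ, contract_contract hu hv hf]
        rcases hc with ⟨rfl, rfl⟩ | h
        · simp [hφ u hu, hφ v hv]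
        · rw [h, one_smul, one_smul, map_neg]
          abel

variable (L) in
/-- Composition of the values of a multilinear map with an endomorphism of `M`. -/
def postcomp (T : Module.End ℂ M) (n : ℕ) : Mult L M n →ₗ[ℂ] Mult L M n where
  toFun f := (T.restrictScalars ℝ).compMultilinearMap f
  map_add' f g := by ext; simp
  map_smul' c f := by ext; simp

theorem postcomp_apply (T : Module.End ℂ M) {n : ℕ} (f : Mult L M n) (U : Fin n → L) :
    postcomp L T n f U = T (f U) := rfl

theorem map_units_smul' {A B F : Type*} [AddCommGroup A] [AddCommGroup B] [FunLike F A B]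
    [AddMonoidHomClass F A B] (T : F) (s : ℤˣ) (x : A) : T (s • x) = s • T x := by
  rcases Int.units_eq_one_or s with rfl | rfl <;> simp

theorem postcomp_mem_cochains (T : Module.End ℂ M) {n : ℕ} {f : Mult L M n}
    (hf : f ∈ cochains L M n) : postcomp L T n f ∈ cochains L M n := by
  intro i j hij p q U hi hj
  rw [postcomp_apply, postcomp_apply, hf i j hij p q U hi hj, map_neg, map_units_smul']

variable [LieSupermodule L M]

variable (M) in
/-- The Lie derivative `θ_u` along a vector `u` of parity `p`. It is defined by recursion on the
degree through `i_v θ_u = (-1)^{uv} θ_u i_v - i_{[u,v]}`, starting from `θ_u m = (-1)^{um} u m` in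
degree `0`. The parity of `u` is a separate argument because a vector does not determine it if it is
zero. -/
def lieDer (p : ZMod 2) (u : L) : (n : ℕ) → Mult L M n →ₗ[ℂ] Mult L M n
  | 0 => postcomp L (act u ∘ₗ parityAut ℂ p) 0
  | n + 1 =>
    { toFun := fun f => LinearMap.uncurryLeft
        ((lieDer p u n).restrictScalars ℝ ∘ₗ f.curryLeft ∘ₗ parityAut ℝ p - f.curryLeft ∘ₗ br u)
      map_add' := fun f g => contract_ext fun u => by
        simp only [map_add, contract_uncurryLeft,
          LinearMap.sub_apply, LinearMap.comp_apply, curryLeft_apply',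
          LinearMap.restrictScalars_apply]
        abel
      map_smul' := fun c f => contract_ext fun u => by
        simp only [map_smul, contract_uncurryLeft, RingHom.id_apply,
          LinearMap.sub_apply, LinearMap.comp_apply, curryLeft_apply',
          LinearMap.restrictScalars_apply, smul_sub] }

theorem lieDer_zero_apply (p : ZMod 2) (u : L) (f : Mult L M 0) (U : Fin 0 → L) :
    lieDer M p u 0 f U = act u (parityAut ℂ p (f U)) := rfl

theorem contract_lieDer {p q : ZMod 2} (u : L) {v : L} (hv : v ∈ gr ℝ q) {n : ℕ}
    (f : Mult L M (n + 1)) :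
    contract M v (lieDer M p u (n + 1) f)
      = (-1 : ℤˣ) ^ (p * q) • lieDer M p u n (contract M v f) - contract M (br u v) f := by
  refine (contract_uncurryLeft _ v).trans ?_
  simp only [LinearMap.sub_apply, LinearMap.comp_apply, curryLeft_apply',
          LinearMap.restrictScalars_apply, parityAut_of_mem p hv, map_units_smul']

theorem parityAut_act {p q : ZMod 2} {u : L} (hu : u ∈ gr ℝ p) (m : M) :
    parityAut ℂ q (act u m) = (-1 : ℤˣ) ^ (q * p) • act u (parityAut ℂ q m) := by
  refine hom_induction (R := ℂ) (P := fun m =>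
    parityAut ℂ q (act u m) = (-1 : ℤˣ) ^ (q * p) • act u (parityAut ℂ q m)) ?_ ?_ m
  · intro x y hx hy
    simp only [map_add, hx, hy, smul_add]
  · intro r x hx
    rw [parityAut_of_mem q (act_mem hu hx), parityAut_of_mem q hx, map_units_smul', smul_smul,
      mul_add, uzpow_add]

/-- The graded Jacobi identity as the statement that `[u, ·]` is a superderivation. -/
theorem br_jacobi' {p q : ZMod 2} {u v : L} (hu : u ∈ gr ℝ p) (hv : v ∈ gr ℝ q) (w : L) :
    br u (br v w) = (-1 : ℤˣ) ^ (p * q) • br v (br u w) + br (br u v) w := by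
  refine hom_induction (R := ℝ) (P := fun w =>
    br u (br v w) = (-1 : ℤˣ) ^ (p * q) • br v (br u w) + br (br u v) w) ?_ ?_ w
  · intro x y hx hy
    simp only [map_add, hx, hy, smul_add]
    abel
  · intro r w hw
    have h := br_jacobi hu hv hw
    rw [br_antisymm (br_mem hv hw) hu, br_antisymm (br_mem hw hu) hv, br_antisymm hw hu] at h
    simp only [map_neg, map_units_smul', smul_neg, smul_smul, neg_neg] at h
    obtain rfl | rfl := Osp12.parity_cases p <;> obtain rfl | rfl := Osp12.parity_cases q <;>
      obtain rfl | rfl := Osp12.parity_cases r <;>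
      simp [show (1 + 1 : ZMod 2) = 0 from rfl] at h ⊢ <;>
      first
        | linear_combination (norm := module) h
        | linear_combination (norm := module) -h

theorem contract_lieDer_lieDer {p q r : ZMod 2} {u v w : L} (hv : v ∈ gr ℝ q) (hw : w ∈ gr ℝ r)
    {n : ℕ} (f : Mult L M (n + 1)) :
    contract M w (lieDer M q v (n + 1) (lieDer M p u (n + 1) f)) =
      (-1 : ℤˣ) ^ ((p + q) * r) • lieDer M q v n (lieDer M p u n (contract M w f))
      - (-1 : ℤˣ) ^ (q * r) • lieDer M q v n (contract M (br u w) f)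
      - (-1 : ℤˣ) ^ (p * (q + r)) • lieDer M p u n (contract M (br v w) f)
      + contract M (br u (br v w)) f := by
  rw [contract_lieDer v hw, contract_lieDer u hw, contract_lieDer u (br_mem hv hw), map_sub,
    map_units_smul', smul_sub, smul_smul, add_mul, uzpow_add, mul_comm]
  abel

/-- The Lie derivatives represent the Lie superalgebra up to sign conventions:
`(-1)^{uv} θ_u θ_v - θ_v θ_u = θ_{[u,v]}`. -/
theorem lieDer_lieDer {p q : ZMod 2} {u v : L} (hu : u ∈ gr ℝ p) (hv : v ∈ gr ℝ q) {n : ℕ}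
    (f : Mult L M n) :
    lieDer M q v n (lieDer M p u n f)
      = (-1 : ℤˣ) ^ (p * q) • lieDer M p u n (lieDer M q v n f)
        - lieDer M (p + q) (br u v) n f := by
  induction n with
  | zero =>
    ext U
    simp only [sub_apply, smul_apply, lieDer_zero_apply]
    rw [parityAut_act hu, parityAut_act hv]
    generalize f U = m
    refine hom_induction (R := ℂ) (P := fun m =>
      act v ((-1 : ℤˣ) ^ (q * p) • act u (parityAut ℂ q (parityAut ℂ p m)))
      = (-1 : ℤˣ) ^ (p * q) • act u ((-1 : ℤˣ) ^ (p * q) • act v (parityAut ℂ p (parityAut ℂ q m)))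
        - act (br u v) (parityAut ℂ (p + q) m)) ?_ ?_ m
    · intro x y hx hy
      simp only [map_add, hx, hy, smul_add]
      abel
    · intro r x hx
      simp only [parityAut_of_mem _ hx, map_units_smul', act_br hu hv]
      obtain rfl | rfl := Osp12.parity_cases p <;> obtain rfl | rfl := Osp12.parity_cases q <;>
      obtain rfl | rfl := Osp12.parity_cases r <;>
      simp [show (1 + 1 : ZMod 2) = 0 from rfl]
  | succ n ih =>
    refine contract_ext_hom fun r w hw => ?_
    have hb := br_mem hu hv
    rw [map_sub, map_units_smul', contract_lieDer_lieDer hv hw, contract_lieDer_lieDer hu hw,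
      contract_lieDer _ hw, ih, br_jacobi' hu hv w, contract_add, contract_unit_smul]
    obtain rfl | rfl := Osp12.parity_cases p <;> obtain rfl | rfl := Osp12.parity_cases q <;>
      obtain rfl | rfl := Osp12.parity_cases r <;>
      simp [show (1 + 1 : ZMod 2) = 0 from rfl] <;> abel

theorem lieDer_mem_cochains {p : ZMod 2} {u : L} (hu : u ∈ gr ℝ p) {n : ℕ} {f : Mult L M n}
    (hf : f ∈ cochains L M n) : lieDer M p u n f ∈ cochains L M n := by
  induction n with
  | zero => exact mem_cochains_zero _
  | succ n ih =>
    have h1 : ∀ v, contract M v (lieDer M p u (n + 1) f) ∈ cochains L M n := by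
      refine hom_induction (R := ℝ) (fun v w hv hw => ?_) fun q v hv => ?_
      · rw [contract_add]
        exact add_mem hv hw
      · rw [contract_lieDer u hv]
        exact sub_mem (units_smul_mem_cochains _ (ih (contract_mem_cochains v hf)))
          (contract_mem_cochains _ hf)
    cases n with
    | zero => exact mem_cochains_one _
    | succ n =>
      refine mem_cochains_of_contract h1 fun {q r v w} hv hw => ?_
      rw [contract_lieDer u hv, contract_lieDer u hw, map_sub, map_sub, map_units_smul',
        map_units_smul', contract_lieDer u hv, contract_lieDer u hw, contract_contract hv hw hf,
        contract_contract (br_mem hu hv) hw hf, contract_contract (br_mem hu hw) hv hf]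
      obtain rfl | rfl := Osp12.parity_cases p <;> obtain rfl | rfl := Osp12.parity_cases q <;>
        obtain rfl | rfl := Osp12.parity_cases r <;>
        simp [show (1 + 1 : ZMod 2) = 0 from rfl] <;> abel

end calculus

/-! ### Cartan's formula -/

section cartan

set_option linter.unusedSectionVars false

variable {L M : Type*} [AddCommGroup L] [Module ℝ L] [LieSuperalgebra L]
  [AddCommGroup M] [Module ℂ M] [Superspace ℂ M]

theorem sum_filter_lt_succ {n : ℕ} (q : ZMod 2) (e : Fin n → ZMod 2) (j : Fin n) :
    ∑ k ∈ Finset.univ.filter (· < j.succ), (Fin.cons q e : Fin (n + 1) → ZMod 2) k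
      = q + ∑ k ∈ Finset.univ.filter (· < j), e k := by
  simp [Finset.sum_filter, Fin.sum_univ_succ]

theorem cons_comp_succAbove {n : ℕ} (v : L) (V : Fin (n + 1) → L) (j : Fin (n + 1)) :
    (fun k => (Fin.cons v V : Fin (n + 2) → L) (j.succ.succAbove k))
      = Fin.cons v (fun k => V (j.succAbove k)) := by
  funext k
  refine Fin.cases ?_ (fun k => ?_) k
  · simp
  · simp

/-- The sum `∑ⱼ (-1)^{j+1} (-1)^{Uⱼ(U₀+⋯+Uⱼ₋₁)} f([u, Uⱼ], U₀, …ĵ…, Uₙ₋₁)`: the part of the Lie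
derivative `θ_u f` coming from the action of `u` on the arguments, for `U k` of parity `d k`. -/
def adSum : {n : ℕ} → Mult L M n → (Fin n → ZMod 2) → L → (Fin n → L) → M
  | 0, _, _, _, _ => 0
  | m + 1, f, d, u, U => ∑ j : Fin (m + 1),
      ((-1 : ℤˣ) ^ ((j : ℕ) + 1) * (-1 : ℤˣ) ^ (d j * ∑ k ∈ Finset.univ.filter (· < j), d k)) •
        f (Fin.cons (br u (U j)) fun k : Fin m => U (j.succAbove k))

theorem apply_cons_cons {n : ℕ} {p q : ZMod 2} {u v : L} (hu : u ∈ gr ℝ p) (hv : v ∈ gr ℝ q)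
    {f : Mult L M (n + 2)} (hf : f ∈ cochains L M (n + 2)) (W : Fin n → L) :
    f (Fin.cons u (Fin.cons v W : Fin (n + 1) → L))
      = -((-1 : ℤˣ) ^ (p * q) • f (Fin.cons v (Fin.cons u W : Fin (n + 1) → L))) :=
  congrArg (fun k : Mult L M n => k W) (contract_contract hu hv hf)

theorem adSum_cons {n : ℕ} {p q : ZMod 2} {u v : L} (hu : u ∈ gr ℝ p) (hv : v ∈ gr ℝ q)
    {f : Mult L M (n + 1)} (hf : f ∈ cochains L M (n + 1)) {e : Fin n → ZMod 2} {V : Fin n → L}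
    (hV : ∀ k, V k ∈ gr ℝ (e k)) :
    adSum f (Fin.cons q e) u (Fin.cons v V)
      = (-1 : ℤˣ) ^ (p * q) • adSum (contract M v f) e u V - f (Fin.cons (br u v) V) := by
  cases n with
  | zero =>
    simp [adSum]
  | succ n =>
    simp only [adSum, Fin.sum_univ_succ (n := n + 1), Fin.cons_zero, Fin.cons_succ,
      sum_filter_lt_succ, cons_comp_succAbove, Finset.smul_sum]
    rw [sub_eq_add_neg, add_comm]
    congr 1
    · refine Finset.sum_congr rfl fun j _ => ?_
      rw [contract_apply, apply_cons_cons (br_mem hu (hV j)) hv hf, smul_smul, smul_neg, smul_smul,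
        ← Units.neg_smul]
      congr 1
      simp only [mul_add, add_mul, uzpow_add, Fin.val_succ, pow_add, pow_one, mul_comm (e j) q]
      rcases Int.units_eq_one_or ((-1 : ℤˣ) ^ (q * e j)) with h | h <;>
      simp [h, mul_comm]
    · simp

variable [LieSupermodule L M]

theorem isHomogeneous_contract {n : ℕ} {s q : ZMod 2} {v : L} (hv : v ∈ gr ℝ q)
    {f : Mult L M (n + 1)} (hf : IsHomogeneous s f) : IsHomogeneous (s + q) (contract M v f) := by
  intro d U hU
  have h := hf (Fin.cons q d) (Fin.cons v U) (fun k => Fin.cases hv hU k)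
  rwa [Fin.sum_univ_succ, Fin.cons_zero, ← add_assoc] at h

/-- The recursively defined Lie derivative in closed form; this is how it is compared with the
coboundary formula. -/
theorem lieDer_apply {n : ℕ} {p s : ZMod 2} {u : L} (hu : u ∈ gr ℝ p) {f : Mult L M n}
    (hf : f ∈ cochains L M n) (hs : IsHomogeneous s f) {d : Fin n → ZMod 2} {U : Fin n → L}
    (hU : ∀ k, U k ∈ gr ℝ (d k)) :
    lieDer M p u n f U = (-1 : ℤˣ) ^ (p * s) • act u (f U) + adSum f d u U := by
  induction n generalizing s with
  | zero =>
    have h := hs d U hU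
    rw [Fin.sum_univ_zero, add_zero] at h
    rw [lieDer_zero_apply, parityAut_of_mem p h, map_units_smul']
    simp [adSum]
  | succ n ih =>
    obtain ⟨v, V, rfl⟩ : ∃ u U', U = Fin.cons u U' := ⟨U 0, Fin.tail U, (Fin.cons_self_tail U).symm⟩
    obtain ⟨q, e, rfl⟩ : ∃ u U', d = Fin.cons u U' := ⟨d 0, Fin.tail d, (Fin.cons_self_tail d).symm⟩
    have hv : v ∈ gr ℝ q := hU 0
    have hV : ∀ k, V k ∈ gr ℝ (e k) := fun k => hU k.succ
    rw [adSum_cons hu hv hf hV]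
    rw [← contract_apply v, contract_lieDer u hv, sub_apply, smul_apply,
      ih (contract_mem_cochains v hf) (isHomogeneous_contract hv hs) hV, smul_add, smul_smul,
      ← uzpow_add, contract_apply, contract_apply]
    rw [show p * q + p * (s + q) = p * s by
      have : ∀ p q s : ZMod 2, p * q + p * (s + q) = p * s := by decide
      exact this p q s]
    abel

theorem actionSum_cons {n : ℕ} {s p : ZMod 2} {u : L} (f : Mult L M (n + 1))
    (d : Fin (n + 1) → ZMod 2) (V : Fin (n + 1) → L) :
    actionSum s f (Fin.cons p d) (Fin.cons u V)
      = (-1 : ℤˣ) ^ (p * s) • act u (f V) - actionSum (s + p) (contract M u f) d V := by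
  simp only [actionSum, Fin.sum_univ_succ (n := n + 1), Fin.cons_zero, Fin.cons_succ,
      sum_filter_lt_succ, cons_comp_succAbove, sub_eq_add_neg]
  congr 1
  · simp
  · rw [← Finset.sum_neg_distrib]
    refine Finset.sum_congr rfl fun j _ => ?_
    rw [contract_apply, ← Units.neg_smul, add_assoc s]
    simp [pow_succ]

theorem bracketSum_cons {n : ℕ} {p : ZMod 2} {u : L} (hu : u ∈ gr ℝ p) {f : Mult L M (n + 1)}
    (hf : f ∈ cochains L M (n + 1))
    {d : Fin (n + 1) → ZMod 2} {V : Fin (n + 1) → L} (hV : ∀ k, V k ∈ gr ℝ (d k)) :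
    bracketSum f (Fin.cons p d) (Fin.cons u V)
      = adSum f d u V - bracketSum (contract M u f) d V := by
  rw [bracketSum, Fin.sum_univ_succ, sub_eq_add_neg]
  congr 1
  · rw [Fin.sum_univ_succ, adSum]
    simp only [Fin.castSucc_zero, lt_self_iff_false, if_false, zero_add, Fin.succ_pos, if_true]
    refine Finset.sum_congr rfl fun j _ => ?_
    congr 1
    · simp [Finset.sum_filter]
      congr 2
      refine (Finset.sum_filter (fun k : Fin (n + 2) => k < j.succ ∧ ¬k = 0) _).trans ?_
      rw [Fin.sum_univ_succ]
      simp [Fin.succ_ne_zero]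
    · congr 1
      refine congrArg₂ (fun (a : L) (W : Fin n → L) => (Fin.cons a W : Fin (n + 1) → L)) rfl ?_
      funext k
      simp
  · cases n with
    | zero => simp [bracketSum]
    | succ n =>
      rw [bracketSum, ← Finset.sum_neg_distrib]
      refine Finset.sum_congr rfl fun i _ => ?_
      rw [← Finset.sum_neg_distrib, Fin.sum_univ_succ]
      simp only [Fin.castSucc_succ, Fin.not_lt_zero, if_false, zero_add, Fin.succ_lt_succ_iff]
      refine Finset.sum_congr rfl fun j _ => ?_
      split_ifs with hij
      · have h : ∑ k ∈ Finset.univ.filter (fun k => k < j.succ ∧ k ≠ i.castSucc.succ),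
            (Fin.cons p d : Fin (n + 3) → ZMod 2) k
              = p + ∑ k ∈ Finset.univ.filter (fun k => k < j ∧ k ≠ i.castSucc), d k := by
          simp [Finset.sum_filter, Fin.sum_univ_succ (n := n + 2),
            (Fin.succ_ne_zero _).symm]
        have hW : (fun k : Fin (n + 1) => (Fin.cons u V : Fin (n + 3) → L)
            (j.succ.succAbove (i.succ.succAbove k)))
            = Fin.cons u fun k => V (j.succAbove (i.succAbove k)) := by
          funext k
          refine Fin.cases ?_ (fun k => ?_) k <;> simp
        rw [h, hW, sum_filter_lt_succ, contract_apply]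
        simp only [Fin.cons_succ]
        rw [apply_cons_cons (br_mem (hV _) (hV _)) hu hf, smul_neg, smul_smul]
        congr 2
        simp only [mul_add, add_mul, uzpow_add, Fin.val_succ, pow_add, pow_one]
        rcases Int.units_eq_one_or ((-1 : ℤˣ) ^ (d i.castSucc * p)) with h1 | h1 <;>
        rcases Int.units_eq_one_or ((-1 : ℤˣ) ^ (d j * p)) with h2 | h2 <;>
        simp [h1, h2]
      · simp

theorem component_apply_of_mem {n : ℕ} (p : ZMod 2) (f : Mult L M n) {d : Fin n → ZMod 2}
    {U : Fin n → L} (hU : ∀ k, U k ∈ gr ℝ (d k)) :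
    component p f U = proj ℂ (p + ∑ k, d k) (f U) := by
  rw [component_apply, Finset.sum_eq_single d]
  · congr 2
    funext k
    exact proj_of_mem ℝ (hU k)
  · intro e _ he
    obtain ⟨k, hk⟩ := Function.ne_iff.mp he
    rw [f.map_coord_zero k (proj_of_mem_of_ne ℝ hk (hU k)), map_zero]
  · simp

theorem isHomogeneous_component {n : ℕ} (p : ZMod 2) (f : Mult L M n) :
    IsHomogeneous p (component p f) := by
  intro d U hU
  rw [component_apply_of_mem p f hU]
  exact proj_mem ℂ _ _

theorem component_add_component {n : ℕ} (f : Mult L M n) : component 0 f + component 1 f = f := by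
  refine mult_ext_hom fun d U hU => ?_
  rw [add_apply, component_apply_of_mem _ f hU, component_apply_of_mem _ f hU]
  generalize ∑ k, d k = q
  obtain rfl | rfl := Osp12.parity_cases q
  · exact proj_zero_add_proj_one ℂ _
  · rw [add_comm]
    exact proj_zero_add_proj_one ℂ _

theorem contract_component {n : ℕ} (p : ZMod 2) {q : ZMod 2} {v : L} (hv : v ∈ gr ℝ q)
    (f : Mult L M (n + 1)) :
    contract M v (component p f) = component (p + q) (contract M v f) := by
  refine mult_ext_hom fun d U hU => ?_
  rw [component_apply_of_mem _ _ hU, contract_apply, contract_apply,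
    component_apply_of_mem p f (d := Fin.cons q d) (fun k => Fin.cases hv hU k),
    Fin.sum_univ_succ, add_assoc]
  rfl

theorem component_mem_cochains {n : ℕ} (p : ZMod 2) {f : Mult L M n} (hf : f ∈ cochains L M n) :
    component p f ∈ cochains L M n := by
  induction n generalizing p with
  | zero => exact mem_cochains_zero _
  | succ n ih =>
    have h1 : ∀ u, contract M u (component p f) ∈ cochains L M n := by
      refine hom_induction (R := ℝ) (fun v w hv hw => ?_) fun q v hv => ?_
      · rw [contract_add]
        exact add_mem hv hw
      · rw [contract_component p hv]
        exact ih _ (contract_mem_cochains v hf)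
    cases n with
    | zero => exact mem_cochains_one _
    | succ n =>
      refine mem_cochains_of_contract h1 fun {q r v w} hv hw => ?_
      rw [contract_component p hv, contract_component p hw, contract_component _ hv,
        contract_component _ hw, contract_contract hv hw hf, add_right_comm]
      refine mult_ext_hom fun d U hU => ?_
      simp only [neg_apply, smul_apply, component_apply_of_mem _ _ hU, map_neg,
        map_units_smul']

/-- Cartan's formula in degree `0`, where the term `∂ i_u` is absent. -/
theorem contract_coboundary_zero {p : ZMod 2} {u : L} (hu : u ∈ gr ℝ p) (f : Mult L M 0) :
    contract M u (coboundary L M 0 f) = lieDer M p u 0 f := by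
  have key : ∀ s, contract M u (coboundary L M 0 (component s f))
      = lieDer M p u 0 (component s f) := by
    intro s
    have hs := isHomogeneous_component s f
    refine mult_ext_hom fun d V hV => ?_
    rw [contract_apply, coboundary_apply hs (d := Fin.cons p d) (fun k => Fin.cases hu hV k),
      lieDer_apply hu (mem_cochains_zero _) hs hV]
    simp [actionSum, bracketSum, adSum]
  rw [← component_add_component f, map_add, map_add, map_add, key, key]

theorem contract_coboundary_hom {n : ℕ} {p s : ZMod 2} {u : L} (hu : u ∈ gr ℝ p)
    {f : Mult L M (n + 1)}
    (hf : f ∈ cochains L M (n + 1)) (hs : IsHomogeneous s f) :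
    contract M u (coboundary L M (n + 1) f)
      = lieDer M p u (n + 1) f - coboundary L M n (contract M u f) := by
  refine mult_ext_hom fun d V hV => ?_
  rw [contract_apply, sub_apply,
    coboundary_apply hs (d := Fin.cons p d) (fun k => Fin.cases hu hV k),
    coboundary_apply (isHomogeneous_contract hu hs) hV, lieDer_apply hu hf hs hV,
    bracketSum_cons hu hf hV, actionSum_cons]
  abel

/-- Cartan's formula `i_u ∂ + ∂ i_u = θ_u` in positive degree. -/
theorem contract_coboundary {n : ℕ} {p : ZMod 2} {u : L} (hu : u ∈ gr ℝ p)
    {f : Mult L M (n + 1)} (hf : f ∈ cochains L M (n + 1)) :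
    contract M u (coboundary L M (n + 1) f)
      = lieDer M p u (n + 1) f - coboundary L M n (contract M u f) := by
  rw [← component_add_component f]
  simp only [map_add]
  rw [contract_coboundary_hom hu (component_mem_cochains 0 hf) (isHomogeneous_component 0 f),
    contract_coboundary_hom hu (component_mem_cochains 1 hf) (isHomogeneous_component 1 f)]
  abel

/-- By Cartan's formula, the insertions of `∂ f` are expressed by `θ_u f` and `∂ (i_u f)`, so
antisymmetry of `∂ f` follows by induction on the degree. -/
theorem coboundary_mem_cochains {n : ℕ} {f : Mult L M n} (hf : f ∈ cochains L M n) :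
    coboundary L M n f ∈ cochains L M (n + 1) := by
  induction n with
  | zero => exact mem_cochains_one _
  | succ n ih =>
    refine mem_cochains_of_contract ?_ fun {p q u v} hu hv => ?_
    · refine hom_induction (R := ℝ) (fun v w hv hw => ?_) fun q v hv => ?_
      · rw [contract_add]
        exact add_mem hv hw
      · rw [contract_coboundary hv hf]
        exact sub_mem (lieDer_mem_cochains hv hf) (ih (contract_mem_cochains v hf))
    · rw [contract_coboundary hu hf, contract_coboundary hv hf, map_sub, map_sub,
        contract_lieDer u hv, contract_lieDer v hu, br_antisymm hv hu]
      have hb : contract M (-((-1 : ℤˣ) ^ (q * p) • br u v)) f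
          = -((-1 : ℤˣ) ^ (q * p) • contract M (br u v) f) := by
        rw [contract_neg, contract_unit_smul]
      rw [hb]
      cases n with
      | zero =>
        rw [contract_coboundary_zero hu, contract_coboundary_zero hv]
        obtain rfl | rfl := Osp12.parity_cases p <;> obtain rfl | rfl := Osp12.parity_cases q <;>
          simp <;> abel
      | succ n =>
        rw [contract_coboundary hu (contract_mem_cochains v hf),
          contract_coboundary hv (contract_mem_cochains u hf), contract_contract hu hv hf, map_neg,
          map_units_smul']
        obtain rfl | rfl := Osp12.parity_cases p <;> obtain rfl | rfl := Osp12.parity_cases q <;>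
          simp <;> abel

theorem lieDer_coboundary {n : ℕ} {p : ZMod 2} {u : L} (hu : u ∈ gr ℝ p) {f : Mult L M n}
    (hf : f ∈ cochains L M n) :
    lieDer M p u (n + 1) (coboundary L M n f) = coboundary L M n (lieDer M p u n f) := by
  induction n with
  | zero =>
    refine contract_ext_hom fun q v hv => ?_
    rw [contract_lieDer u hv, contract_coboundary_zero hv, contract_coboundary_zero hv,
      contract_coboundary_zero (br_mem hu hv), lieDer_lieDer hu hv]
  | succ n ih =>
    refine contract_ext_hom fun q v hv => ?_
    rw [contract_lieDer u hv, contract_coboundary hv hf, contract_coboundary (br_mem hu hv) hf,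
      contract_coboundary hv (lieDer_mem_cochains hu hf), lieDer_lieDer hu hv,
      contract_lieDer u hv, map_sub, map_sub, map_units_smul', ih (contract_mem_cochains v hf),
      smul_sub]
    abel

theorem coboundary_coboundary {n : ℕ} {f : Mult L M n} (hf : f ∈ cochains L M n) :
    coboundary L M (n + 1) (coboundary L M n f) = 0 := by
  induction n with
  | zero =>
    refine contract_ext_hom fun q v hv => ?_
    rw [contract_coboundary hv (coboundary_mem_cochains hf), contract_coboundary_zero hv,
      lieDer_coboundary hv hf, sub_self, map_zero]
  | succ n ih =>
    refine contract_ext_hom fun q v hv => ?_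
    rw [contract_coboundary hv (coboundary_mem_cochains hf), contract_coboundary hv hf,
      lieDer_coboundary hv hf, map_sub, ih (contract_mem_cochains v hf), sub_zero, sub_self,
      map_zero]

end cartan

/-! ### Lie derivatives of exterior products -/

section wedge_lieDer

set_option linter.unusedSectionVars false

variable {L M : Type*} [AddCommGroup L] [Module ℝ L] [LieSuperalgebra L]
  [AddCommGroup M] [Module ℂ M] [Superspace ℂ M]

theorem map_real_smul {V W : Type*} [AddCommGroup V] [Module ℂ V] [AddCommGroup W] [Module ℂ W]
    (T : V →ₗ[ℂ] W) (r : ℝ) (x : V) : T (r • x) = r • T x :=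
  (T.restrictScalars ℝ).map_smul r x

theorem wedge_wedge (φ : L →ₗ[ℝ] ℝ) {n : ℕ} (f : Mult L M n) :
    wedge M φ (n + 1) (wedge M φ n f) = 0 := by
  induction n with
  | zero =>
    refine contract_ext fun u => ?_
    rw [contract_wedge_succ, contract_wedge_zero, map_real_smul, sub_self, map_zero]
  | succ n ih =>
    refine contract_ext fun u => ?_
    rw [contract_wedge_succ, contract_wedge_succ, map_sub, ih, map_real_smul, sub_zero, sub_self,
      map_zero]

variable [LieSupermodule L M]

theorem lieDer_wedge {φ : L →ₗ[ℝ] ℝ} (hφ : ∀ u ∈ (gr ℝ 1 : Submodule ℝ L), φ u = 0) {p : ZMod 2}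
    {u : L} (h : ∀ v, φ (br u v) = 0) {n : ℕ} (f : Mult L M n) :
    lieDer M p u (n + 1) (wedge M φ n f) = wedge M φ n (lieDer M p u n f) := by
  have hs : ∀ {q : ZMod 2} {v : L}, v ∈ gr ℝ q → ∀ {k : ℕ} (f : Mult L M k),
      (-1 : ℤˣ) ^ (p * q) • φ v • f = φ v • f := by
    intro q v hv k f
    obtain rfl | rfl := Osp12.parity_cases q
    · simp
    · simp [hφ v hv]
  induction n with
  | zero =>
    refine contract_ext_hom fun q v hv => ?_
    rw [contract_lieDer u hv, contract_wedge_zero, contract_wedge_zero, contract_wedge_zero, h,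
      zero_smul, sub_zero, map_real_smul, hs hv]
  | succ n ih =>
    refine contract_ext_hom fun q v hv => ?_
    rw [contract_lieDer u hv, contract_wedge_succ, contract_wedge_succ, contract_wedge_succ, h,
      zero_smul, zero_sub, map_sub, ih, map_real_smul, smul_sub, hs hv, contract_lieDer u hv,
      map_sub, map_units_smul']
    abel

theorem lieDer_smul (p : ZMod 2) (c : ℝ) (u : L) {n : ℕ} (f : Mult L M n) :
    lieDer M p (c • u) n f = c • lieDer M p u n f := by
  induction n with
  | zero =>
    ext U
    rw [smul_apply, lieDer_zero_apply, lieDer_zero_apply, map_smul]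
    rfl
  | succ n ih =>
    refine contract_ext_hom fun q v hv => ?_
    rw [contract_real_smul, contract_lieDer _ hv, contract_lieDer _ hv, ih, map_smul,
      LinearMap.smul_apply, contract_smul, smul_sub, smul_comm]

end wedge_lieDer

/-! ### Total cochains -/

section total

set_option linter.unusedSectionVars false

variable (L M : Type*) [AddCommGroup L] [Module ℝ L] [LieSuperalgebra L]
  [AddCommGroup M] [Module ℂ M] [Superspace ℂ M]

/-- Sequences of cochains, one in each degree. Unlike the graded pieces, this space carries the
insertions, the coboundary, etc. as endomorphisms. -/
abbrev TotalCochains : Type _ := ∀ n, cochains L M n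

variable {L}

/-- The insertion `i_u` on total cochains. -/
def contraction (u : L) : Module.End ℂ (TotalCochains L M) where
  toFun F n := ⟨contract M u (F (n + 1)), contract_mem_cochains u (F (n + 1)).2⟩
  map_add' _ _ := rfl
  map_smul' _ _ := rfl

/-- Exterior multiplication by a linear form that vanishes on odd vectors, on total cochains. -/
def wedgeEnd (φ : L →ₗ[ℝ] ℝ) (hφ : ∀ u ∈ (gr ℝ 1 : Submodule ℝ L), φ u = 0) :
    Module.End ℂ (TotalCochains L M) where
  toFun F
    | 0 => 0
    | n + 1 => ⟨wedge M φ n (F n), wedge_mem_cochains hφ (F n).2⟩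
  map_add' F G := by
    funext n
    cases n with
    | zero => exact (add_zero _).symm
    | succ n => exact Subtype.ext (map_add _ _ _)
  map_smul' c F := by
    funext n
    cases n with
    | zero => exact (smul_zero c).symm
    | succ n => exact Subtype.ext (map_smul (wedge M φ n) c _)

variable (L) {M} in
/-- Composition of values with an endomorphism of `M`, on total cochains. -/
def postcompEnd (T : Module.End ℂ M) : Module.End ℂ (TotalCochains L M) where
  toFun F n := ⟨postcomp L T n (F n), postcomp_mem_cochains T (F n).2⟩
  map_add' _ _ := funext fun _ => Subtype.ext (map_add _ _ _)
  map_smul' c _ := funext fun _ => Subtype.ext (map_smul (postcomp L T _) c _)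

variable [LieSupermodule L M]

variable (L) in
/-- The coboundary operator on total cochains. -/
def differential : Module.End ℂ (TotalCochains L M) where
  toFun F
    | 0 => 0
    | n + 1 => ⟨coboundary L M n (F n), coboundary_mem_cochains (F n).2⟩
  map_add' F G := by
    funext n
    cases n with
    | zero => exact (add_zero _).symm
    | succ n => exact Subtype.ext (map_add _ _ _)
  map_smul' c F := by
    funext n
    cases n with
    | zero => exact (smul_zero c).symm
    | succ n => exact Subtype.ext (map_smul (coboundary L M n) c _)

/-- The Lie derivative along a homogeneous vector, on total cochains. -/
def lieDerivative {p : ZMod 2} {u : L} (hu : u ∈ gr ℝ p) : Module.End ℂ (TotalCochains L M) where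
  toFun F n := ⟨lieDer M p u n (F n), lieDer_mem_cochains hu (F n).2⟩
  map_add' _ _ := funext fun _ => Subtype.ext (map_add _ _ _)
  map_smul' c _ := funext fun _ => Subtype.ext (map_smul (lieDer M p u _) c _)

variable {M}

theorem contraction_coe (u : L) (F : TotalCochains L M) (n : ℕ) :
    (contraction M u F n : Mult L M n) = contract M u (F (n + 1)) := rfl

theorem differential_succ (F : TotalCochains L M) (n : ℕ) :
    (differential L M F (n + 1) : Mult L M (n + 1)) = coboundary L M n (F n) := rfl

theorem contraction_add (u v : L) : contraction M (u + v) = contraction M u + contraction M v :=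
  LinearMap.ext fun _ => funext fun _ => Subtype.ext (contract_add u v _)

theorem contraction_smul (c : ℝ) (u : L) : contraction M (c • u) = (c : ℂ) • contraction M u :=
  LinearMap.ext fun _ => funext fun _ => Subtype.ext (contract_smul c u _)

theorem contraction_neg (u : L) : contraction M (-u) = -contraction M u :=
  LinearMap.ext fun _ => funext fun _ => Subtype.ext (contract_neg u _)

theorem contraction_zero : contraction M (0 : L) = 0 := by
  simpa using contraction_smul (M := M) 0 (0 : L)

theorem contraction_mul_contraction {p q : ZMod 2} {u v : L} (hu : u ∈ gr ℝ p) (hv : v ∈ gr ℝ q) :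
    contraction M v * contraction M u
      = -((-1 : ℤˣ) ^ (p * q) • (contraction M u * contraction M v)) :=
  LinearMap.ext fun F => funext fun n => Subtype.ext (by
    refine (contract_contract hu hv (F (n + 2)).2).trans ?_
    rcases Int.units_eq_one_or ((-1 : ℤˣ) ^ (p * q)) with h | h <;> simp [h] <;> rfl)

/-- Cartan's formula on total cochains; in degree `0` the term `∂ i_u` has component zero. -/
theorem contraction_mul_differential {p : ZMod 2} {u : L} (hu : u ∈ gr ℝ p) :
    contraction M u * differential L M = lieDerivative M hu - differential L M * contraction M u :=
  LinearMap.ext fun F => funext fun n => Subtype.ext (by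
    cases n with
    | zero => exact (contract_coboundary_zero hu _).trans (sub_zero _).symm
    | succ n => exact contract_coboundary hu (F (n + 1)).2)

theorem differential_differential (F : TotalCochains L M) :
    differential L M (differential L M F) = 0 :=
  funext fun n => Subtype.ext (by
    match n with
    | 0 => rfl
    | 1 => exact map_zero _
    | n + 2 => exact coboundary_coboundary (F n).2)

theorem contraction_mul_lieDerivative {p q : ZMod 2} {u v : L} (hu : u ∈ gr ℝ p)
    (hv : v ∈ gr ℝ q) :
    contraction M v * lieDerivative M hu
      = (-1 : ℤˣ) ^ (p * q) • (lieDerivative M hu * contraction M v) - contraction M (br u v) :=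
  LinearMap.ext fun F => funext fun n => Subtype.ext (by
    refine (contract_lieDer u hv (F (n + 1)).1).trans ?_
    rcases Int.units_eq_one_or ((-1 : ℤˣ) ^ (p * q)) with h | h <;> simp [h] <;> rfl)

theorem contraction_mul_wedgeEnd {φ : L →ₗ[ℝ] ℝ} (hφ : ∀ u ∈ (gr ℝ 1 : Submodule ℝ L), φ u = 0)
    (u : L) :
    contraction M u * wedgeEnd M φ hφ = (φ u : ℂ) • 1 - wedgeEnd M φ hφ * contraction M u :=
  LinearMap.ext fun F => funext fun n => Subtype.ext (by
    cases n with
    | zero =>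
      refine (contract_wedge_zero φ u _).trans ?_
      exact (sub_zero _).symm
    | succ n => exact contract_wedge_succ φ u _)

theorem wedgeEnd_wedgeEnd {φ : L →ₗ[ℝ] ℝ} (hφ : ∀ u ∈ (gr ℝ 1 : Submodule ℝ L), φ u = 0)
    (F : TotalCochains L M) : wedgeEnd M φ hφ (wedgeEnd M φ hφ F) = 0 :=
  funext fun n => Subtype.ext (by
    match n with
    | 0 => rfl
    | 1 => exact map_zero _
    | n + 2 => exact wedge_wedge φ _)

theorem lieDerivative_wedgeEnd {φ : L →ₗ[ℝ] ℝ} (hφ : ∀ u ∈ (gr ℝ 1 : Submodule ℝ L), φ u = 0)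
    {p : ZMod 2} {u : L} (hu : u ∈ gr ℝ p) (h : ∀ v, φ (br u v) = 0) (F : TotalCochains L M) :
    lieDerivative M hu (wedgeEnd M φ hφ F) = wedgeEnd M φ hφ (lieDerivative M hu F) :=
  funext fun n => Subtype.ext (by
    cases n with
    | zero => exact map_zero _
    | succ n => exact lieDer_wedge hφ h _)

/-- The total cochains that vanish in degrees greater than `d`. -/
def DegreeLE (d : ℕ) : Submodule ℂ (TotalCochains L M) where
  carrier := {F | ∀ n, d < n → F n = 0}
  zero_mem' _ _ := rfl
  add_mem' hF hG n hn := by rw [Pi.add_apply, hF n hn, hG n hn, add_zero]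
  smul_mem' c F hF n hn := by rw [Pi.smul_apply, hF n hn, smul_zero]

theorem lieDerivative_mem_degreeLE {p : ZMod 2} {u : L} (hu : u ∈ gr ℝ p) {d : ℕ}
    {F : TotalCochains L M} (hF : F ∈ DegreeLE d) : lieDerivative M hu F ∈ DegreeLE d := by
  intro n hn
  refine Subtype.ext ?_
  change lieDer M p u n (F n) = 0
  rw [hF n hn]
  exact map_zero _

/-- A cochain of degree at most `d` is killed by `d + 1` insertions. -/
theorem contraction_pow_eq_zero (u : L) (d : ℕ) {F : TotalCochains L M} (hF : F ∈ DegreeLE d) :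
    (contraction M u ^ (d + 1)) F = 0 := by
  have hs : ∀ G : TotalCochains L M, ∀ n, G (n + 1) = 0 → contraction M u G n = 0 := by
    intro G n h
    refine Subtype.ext ?_
    rw [contraction_coe, h]
    exact map_zero _
  induction d generalizing F with
  | zero =>
    rw [zero_add, pow_one]
    exact funext fun n => hs F n (hF _ (by omega))
  | succ d ih =>
    rw [pow_succ]
    exact ih fun n hn => hs F n (hF _ (by omega))

theorem differential_wedgeEnd_mem_degreeLE {φ : L →ₗ[ℝ] ℝ}
    (hφ : ∀ u ∈ (gr ℝ 1 : Submodule ℝ L), φ u = 0) (u : L) (κ : ℂ) {d : ℕ} {F : TotalCochains L M}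
    (hF : F ∈ DegreeLE d) :
    differential L M (κ • wedgeEnd M φ hφ ((contraction M u ^ 2) F)) ∈ DegreeLE d := by
  rw [map_smul]
  refine Submodule.smul_mem _ _ fun n hn => Subtype.ext ?_
  match n with
  | 0 => rfl
  | 1 => exact map_zero _
  | n + 2 =>
    have h : (contraction M u ^ 2) F n = 0 := Subtype.ext (by
      change contract M u (contract M u (F (n + 2)).1) = 0
      rw [hF _ hn]
      exact (congrArg _ (map_zero _)).trans (map_zero _))
    change coboundary L M (n + 1) (wedge M φ n ((contraction M u ^ 2) F n)) = 0
    rw [h]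
    exact (congrArg _ (map_zero _)).trans (map_zero _)

theorem eq_zero_of_contraction {F : TotalCochains L M} {n : ℕ}
    (h : ∀ (p : ZMod 2) (u : L), u ∈ gr ℝ p → contraction M u F n = 0) : F (n + 1) = 0 :=
  Subtype.ext (contract_ext_hom fun p u hu => (congrArg Subtype.val (h p u hu)).trans
    (map_zero (contract M u)).symm)

end total

/-! ### Elimination of powers of an odd insertion -/

section elimination

variable {R : Type*} [Ring R] [Algebra ℂ R] {c : ℂ} {U D Θ X E : R}

/-- The commutation of a power of `U = i_u` with `D = ∂`, for `u` odd with `[u, u] = c x`,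
`X = i_x` and `Θ = θ_u`. The coefficient of the last term is `c` times a binomial coefficient. -/
theorem pow_mul_differential (h1 : U * D = Θ - D * U) (h2 : U * Θ = -(Θ * U) - c • X)
    (h3 : U * X = -(X * U)) (k : ℕ) :
    U ^ (k + 2) * D = (-1 : ℂ) ^ k • (D * U ^ (k + 2) - ((k : ℂ) + 2) • (Θ * U ^ (k + 1))
      - ((k + 2) * (k + 1) / 2 * c : ℂ) • (X * U ^ k)) := by
  induction k with
  | zero =>
    have : U ^ 2 * D = U * (U * D) := by rw [pow_two, mul_assoc]
    rw [zero_add, this, h1, mul_sub, h2, ← mul_assoc, h1]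
    simp only [pow_zero, Nat.cast_zero, pow_one, mul_one, sub_mul, pow_two, mul_assoc, zero_add]
    module
  | succ k ih =>
    have e1 : U * (D * U ^ (k + 2)) = Θ * U ^ (k + 2) - D * U ^ (k + 3) := by
      rw [← mul_assoc, h1, sub_mul, mul_assoc, ← pow_succ']
    have e2 : U * (Θ * U ^ (k + 1)) = -(Θ * U ^ (k + 2)) - c • (X * U ^ (k + 1)) := by
      rw [← mul_assoc, h2, sub_mul, neg_mul, mul_assoc, ← pow_succ', smul_mul_assoc]
    have e3 : U * (X * U ^ k) = -(X * U ^ (k + 1)) := by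
      rw [← mul_assoc, h3, neg_mul, mul_assoc, ← pow_succ']
    have e0 : U ^ (k + 1 + 2) * D = U * (U ^ (k + 2) * D) := by
      rw [← mul_assoc, ← pow_succ']
    rw [e0, ih, mul_smul_comm, mul_sub, mul_sub, mul_smul_comm, mul_smul_comm, e1, e2, e3,
      show k + 1 + 2 = k + 3 by ring, show k + 1 + 1 = k + 2 by ring]
    push_cast
    rw [pow_succ]
    module

theorem pow_mul_wedge (h4 : U * E = -(E * U)) (k : ℕ) :
    U ^ k * E = (-1 : ℂ) ^ k • (E * U ^ k) := by
  induction k with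
  | zero => simp
  | succ k ih =>
    rw [pow_succ', mul_assoc, ih, mul_smul_comm, ← mul_assoc, h4, pow_succ', neg_mul, mul_assoc]
    simp

end elimination

/-- If `U = i_u` satisfies `U ^ (k + 3) f = 0` for a cocycle `f`, a multiple of `∂ (x* ∧ U ^ 2 f)`
corrects `f` so that already `U ^ (k + 2)` kills it. The scalar is the inverse of the coefficient of
the last term in `pow_mul_differential`, up to sign. -/
theorem elimination_step {W : Type*} [AddCommGroup W] [Module ℂ W] {c : ℂ} (hc : c ≠ 0)
    {U D Θ X E : Module.End ℂ W} (h1 : U * D = Θ - D * U) (h2 : U * Θ = -(Θ * U) - c • X)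
    (h3 : U * X = -(X * U)) (h4 : U * E = -(E * U)) (h5 : X * E = 1 - E * X) {f : W} (hf : D f = 0)
    {k : ℕ} (hk : (U ^ (k + 3)) f = 0) :
    (U ^ (k + 2)) (f - (-1 / ((k + 2) * (k + 1) / 2 * c) : ℂ) • D (E ((U ^ 2) f))) = 0 := by
  have hz : ∀ m, k + 3 ≤ m → (U ^ m) f = 0 := by
    intro m hm
    obtain ⟨l, rfl⟩ := Nat.exists_eq_add_of_le' hm
    rw [pow_add, Module.End.mul_apply, hk, map_zero]
  have hcoef : ∀ m : ℕ, (((m : ℂ) + 2) * (m + 1) / 2 * c : ℂ) ≠ 0 := by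
    intro m
    refine mul_ne_zero (div_ne_zero (mul_ne_zero ?_ ?_) two_ne_zero) hc
    · exact_mod_cast Nat.succ_ne_zero (m + 1)
    · exact_mod_cast Nat.succ_ne_zero m
  have hpow : ∀ (m : ℕ) (g : W), (U ^ (m + 2)) (D g) = (-1 : ℂ) ^ m • (D ((U ^ (m + 2)) g)
      - ((m : ℂ) + 2) • Θ ((U ^ (m + 1)) g)
      - ((m + 2) * (m + 1) / 2 * c : ℂ) • X ((U ^ m) g)) := fun m g =>
    congrArg (fun T : Module.End ℂ W => T g) (pow_mul_differential h1 h2 h3 m)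
  -- `0 = U ^ (k + 4) (D f)` leaves only the `X`-term, whose coefficient is nonzero
  have hX : X ((U ^ (k + 2)) f) = 0 := by
    have h := hpow (k + 2) f
    rw [hf, map_zero, hz (k + 2 + 2) (by omega), hz (k + 2 + 1) (by omega), map_zero, map_zero,
      smul_zero, sub_zero, zero_sub] at h
    have h' := (smul_eq_zero.mp h.symm).resolve_left (pow_ne_zero _ (by norm_num))
    exact (smul_eq_zero.mp (neg_eq_zero.mp h')).resolve_left (hcoef _)
  have hUE : ∀ m, (U ^ m) (E ((U ^ 2) f)) = (-1 : ℂ) ^ m • E ((U ^ (m + 2)) f) := by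
    intro m
    have := congrArg (fun T : Module.End ℂ W => T ((U ^ 2) f)) (pow_mul_wedge h4 m)
    rw [pow_add]
    exact this
  have hXE : X (E ((U ^ (k + 2)) f)) = (U ^ (k + 2)) f := by
    have := congrArg (fun T : Module.End ℂ W => T ((U ^ (k + 2)) f)) h5
    simpa [hX] using this
  rw [map_sub, map_smul, hpow, hUE, hUE, hUE, hz (k + 2 + 2) (by omega), hz (k + 1 + 2) (by omega)]
  simp only [map_zero, smul_zero, map_smul, hXE, sub_zero, zero_sub, smul_neg, smul_smul]
  have hs : (-1 : ℂ) ^ k * (-1) ^ k = 1 := by rw [← mul_pow]; simp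
  have : (-1 / (((k : ℂ) + 2) * (k + 1) / 2 * c)) *
      ((-1) ^ k * ((k + 2) * (k + 1) / 2 * c * (-1) ^ k)) = -1 := by
    rw [show ((-1 : ℂ) ^ k * ((k + 2) * (k + 1) / 2 * c * (-1) ^ k))
      = ((k + 2) * (k + 1) / 2 * c) * ((-1) ^ k * (-1) ^ k) by ring, hs, mul_one,
      div_mul_cancel₀ _ (hcoef k)]
  rw [this]
  simp

/-- Iterated elimination: a cocycle killed by a power of `U = i_u` is cohomologous to one killed by
`U ^ 2`, keeping any property `P` that survives the corrections. -/
theorem exists_elimination {W : Type*} [AddCommGroup W] [Module ℂ W] {c : ℂ} (hc : c ≠ 0)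
    {U D Θ X E : Module.End ℂ W} (h1 : U * D = Θ - D * U) (h2 : U * Θ = -(Θ * U) - c • X)
    (h3 : U * X = -(X * U)) (h4 : U * E = -(E * U)) (h5 : X * E = 1 - E * X)
    (hD : ∀ g, D (D g) = 0) (P : W → Prop)
    (hP : ∀ (f : W) (κ : ℂ), D f = 0 → P f → P (f - D (κ • E ((U ^ 2) f))))
    (k : ℕ) {f : W} (hf : D f = 0) (hPf : P f) (hk : (U ^ (k + 2)) f = 0) :
    ∃ g, (U ^ 2) (f - D g) = 0 ∧ P (f - D g) := by
  induction k generalizing f with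
  | zero => exact ⟨0, by simpa using hk, by simpa using hPf⟩
  | succ k ih =>
    have h := elimination_step hc h1 h2 h3 h4 h5 hf hk
    rw [← map_smul] at h
    obtain ⟨g, hg⟩ := ih (by rw [map_sub, hf, hD, sub_zero]) (hP f _ hf hPf) h
    rw [sub_sub, ← map_add] at hg
    exact ⟨_, hg⟩

/-! ### The operators for `osp(1|2)` -/

namespace Osp12

theorem e_mem (s : Gen) : e s ∈ (gr ℝ s.parity : Submodule ℝ Osp12) := by
  intro t ht
  refine if_neg ?_
  rintro rfl
  exact ht rfl

/-- The linear form `s*` of the basis dual to `H, X, Y, A, B`. -/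
def coord (s : Gen) : Osp12 →ₗ[ℝ] ℝ := LinearMap.proj (φ := fun _ : Gen => ℝ) s

theorem coord_e (s t : Gen) : coord s (e t) = if s = t then 1 else 0 := rfl

/-- The dual basis vectors of `H`, `X`, `Y` vanish on odd vectors. -/
theorem coord_odd {s : Gen} (hs : s.parity = 0) (u : Osp12)
    (hu : u ∈ (gr ℝ 1 : Submodule ℝ Osp12)) : coord s u = 0 :=
  hu s (by rw [hs]; decide)

theorem sum_gen {V : Type*} [AddCommMonoid V] (g : Gen → V) :
    ∑ s, g s = g .H + (g .X + (g .Y + (g .A + g .B))) := by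
  have : (Finset.univ : Finset Gen) = {.H, .X, .Y, .A, .B} := rfl
  rw [this]
  simp

theorem eq_sum_e (u : Osp12) : u = ∑ s, u s • e s := by
  have h : ∀ (a : ℝ) (v : Osp12) (t : Gen), (a • v) t = a * v t := fun _ _ _ => rfl
  have h' : ∀ (v w : Osp12) (t : Gen), (v + w) t = v t + w t := fun _ _ _ => rfl
  funext t
  rw [sum_gen]
  cases t <;> simp [h, h', e]

variable (M : Type*) [AddCommGroup M] [Module ℂ M] [Superspace ℂ M]

/-- The insertion of a basis vector. -/
abbrev ι (s : Gen) : Module.End ℂ (TotalCochains Osp12 M) := contraction M (e s)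

/-- Exterior multiplication by `Y*`. -/
abbrev wedgeY : Module.End ℂ (TotalCochains Osp12 M) := wedgeEnd M (coord .Y) (coord_odd rfl)

/-- Exterior multiplication by `X*`. -/
abbrev wedgeX : Module.End ℂ (TotalCochains Osp12 M) := wedgeEnd M (coord .X) (coord_odd rfl)

variable [LieSupermodule Osp12 M]

/-- The Lie derivative along a basis vector. -/
abbrev θ (s : Gen) : Module.End ℂ (TotalCochains Osp12 M) := lieDerivative M (e_mem s)

/-- The coboundary operator for `osp(1|2)`. -/
abbrev δ : Module.End ℂ (TotalCochains Osp12 M) := differential Osp12 M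

variable {M}

set_option linter.unusedSectionVars false

local notation "W" => TotalCochains Osp12 M

theorem contraction_eq_zero {F : W} {n : ℕ} (h : ∀ s, ι M s F n = 0) (u : Osp12) :
    contraction M u F n = 0 := by
  rw [eq_sum_e u, sum_gen]
  simp only [contraction_add, contraction_smul, LinearMap.add_apply, LinearMap.smul_apply,
    Pi.add_apply, Pi.smul_apply]
  simp only [h, smul_zero, add_zero]

theorem eq_zero_of_ι {F : W} {n : ℕ} (h : ∀ s, ι M s F n = 0) : F (n + 1) = 0 :=
  eq_zero_of_contraction fun _ u _ => contraction_eq_zero h u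

theorem mem_degreeLE_of_ι {F : W} {d : ℕ} (h : ∀ s, ι M s F ∈ DegreeLE d) :
    F ∈ DegreeLE (d + 1) := by
  intro n hn
  obtain ⟨n, rfl⟩ := Nat.exists_eq_add_of_le' (Nat.one_le_of_lt hn)
  exact eq_zero_of_ι fun s => h s n (by omega)

theorem mem_degreeLE_zero_of_ι {F : W} (h : ∀ s, ι M s F = 0) : F ∈ DegreeLE 0 := by
  intro n hn
  obtain ⟨n, rfl⟩ := Nat.exists_eq_add_of_le' hn
  exact eq_zero_of_ι fun s => congrFun (h s) n

theorem ι_ι_even {s : Gen} (hs : s.parity = 0) (t : Gen) (F : W) :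
    ι M t (ι M s F) = -ι M s (ι M t F) := by
  have h := LinearMap.congr_fun (contraction_mul_contraction (M := M) (e_mem s) (e_mem t)) F
  simpa [hs] using h

theorem ι_ι_even' {t : Gen} (ht : t.parity = 0) (s : Gen) (F : W) :
    ι M t (ι M s F) = -ι M s (ι M t F) := by
  rw [ι_ι_even ht, neg_neg]

theorem ι_ι_self {s : Gen} (hs : s.parity = 0) (F : W) : ι M s (ι M s F) = 0 := by
  have h := ι_ι_even hs s F
  have h2 : (2 : ℂ) • ι M s (ι M s F) = 0 := by
    rw [two_smul]
    nth_rewrite 1 [h]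
    exact neg_add_cancel _
  exact (smul_eq_zero.mp h2).resolve_left two_ne_zero

theorem ι_ι_odd {s t : Gen} (hs : s.parity = 1) (ht : t.parity = 1) (F : W) :
    ι M t (ι M s F) = ι M s (ι M t F) := by
  have h := LinearMap.congr_fun (contraction_mul_contraction (M := M) (e_mem s) (e_mem t)) F
  simpa [hs, ht] using h

theorem ι_ι_eq_zero {s t : Gen} {F : W} (h : ι M t F = 0) : ι M t (ι M s F) = 0 := by
  by_cases hs : s.parity = 0
  · rw [ι_ι_even hs, h, map_zero, neg_zero]
  by_cases ht : t.parity = 0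
  · rw [ι_ι_even' ht, h, map_zero, neg_zero]
  · rw [ι_ι_odd ((parity_cases _).resolve_left hs) ((parity_cases _).resolve_left ht), h, map_zero]

theorem ι_δ (s : Gen) (F : W) : ι M s (δ M F) = θ M s F - δ M (ι M s F) :=
  LinearMap.congr_fun (contraction_mul_differential (e_mem s)) F

theorem ι_θ_even {s t : Gen} (h : s.parity * t.parity = 0) (F : W) :
    ι M t (θ M s F) = θ M s (ι M t F) - contraction M (brGen s t) F := by
  have h' := LinearMap.congr_fun (contraction_mul_lieDerivative (M := M) (e_mem s) (e_mem t)) F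
  rw [show (br (e s) (e t) : Osp12) = brGen s t from bracket_e s t] at h'
  simpa [h] using h'

theorem ι_θ_odd {s t : Gen} (h : s.parity * t.parity = 1) (F : W) :
    ι M t (θ M s F) = -θ M s (ι M t F) - contraction M (brGen s t) F := by
  have h' := LinearMap.congr_fun (contraction_mul_lieDerivative (M := M) (e_mem s) (e_mem t)) F
  rw [show (br (e s) (e t) : Osp12) = brGen s t from bracket_e s t] at h'
  simpa [h] using h'

theorem ιA_θA (F : W) : ι M .A (θ M .A F) = -θ M .A (ι M .A F) - (2 : ℂ) • ι M .X F := by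
  rw [ι_θ_odd rfl, brGen, contraction_smul]; simp

theorem ιB_θA (F : W) : ι M .B (θ M .A F) = -θ M .A (ι M .B F) - (2 : ℂ) • ι M .H F := by
  rw [ι_θ_odd rfl, brGen, contraction_smul]; simp

theorem ιH_θA (F : W) : ι M .H (θ M .A F) = θ M .A (ι M .H F) + (1 / 2 : ℂ) • ι M .A F := by
  rw [ι_θ_even rfl, brGen, contraction_neg, contraction_smul]; simp

theorem ιY_θA (F : W) : ι M .Y (θ M .A F) = θ M .A (ι M .Y F) - ι M .B F := by
  rw [ι_θ_even rfl, brGen]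

theorem ιA_θB (F : W) : ι M .A (θ M .B F) = -θ M .B (ι M .A F) - (2 : ℂ) • ι M .H F := by
  rw [ι_θ_odd rfl, brGen, contraction_smul]; simp

theorem ιB_θB (F : W) : ι M .B (θ M .B F) = -θ M .B (ι M .B F) + (2 : ℂ) • ι M .Y F := by
  rw [ι_θ_odd rfl, brGen, contraction_neg, contraction_smul]; simp

theorem ιX_θB (F : W) : ι M .X (θ M .B F) = θ M .B (ι M .X F) - ι M .A F := by
  rw [ι_θ_even rfl, brGen]

theorem ιH_θB (F : W) : ι M .H (θ M .B F) = θ M .B (ι M .H F) - (1 / 2 : ℂ) • ι M .B F := by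
  rw [ι_θ_even rfl, brGen, contraction_smul]; simp

theorem ι_wedgeY {s : Gen} (hs : s ≠ .Y) (F : W) : ι M s (wedgeY M F) = -wedgeY M (ι M s F) := by
  have h := LinearMap.congr_fun
    (contraction_mul_wedgeEnd (M := M) (φ := coord .Y) (coord_odd rfl) (e s)) F
  simpa [coord_e, hs.symm] using h

theorem ιY_wedgeY (F : W) : ι M .Y (wedgeY M F) = F - wedgeY M (ι M .Y F) := by
  have h := LinearMap.congr_fun
    (contraction_mul_wedgeEnd (M := M) (φ := coord .Y) (coord_odd rfl) (e .Y)) F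
  simpa [coord_e] using h

theorem ιA_wedgeX (F : W) : ι M .A (wedgeX M F) = -wedgeX M (ι M .A F) := by
  have h := LinearMap.congr_fun
    (contraction_mul_wedgeEnd (M := M) (φ := coord .X) (coord_odd rfl) (e .A)) F
  simpa [coord_e] using h

theorem ιX_wedgeX (F : W) : ι M .X (wedgeX M F) = F - wedgeX M (ι M .X F) := by
  have h := LinearMap.congr_fun
    (contraction_mul_wedgeEnd (M := M) (φ := coord .X) (coord_odd rfl) (e .X)) F
  simpa [coord_e] using h

/-- If `Y* ∧ F = 0` then `F` is a multiple of `Y*`. -/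
theorem wedgeY_ιY {F : W} (h : wedgeY M F = 0) : wedgeY M (ι M .Y F) = F := by
  have := ιY_wedgeY F
  rw [h, map_zero] at this
  exact (sub_eq_zero.mp this.symm).symm

/-- `θ_A` commutes with `Y* ∧ ·`, because no bracket `[A, v]` has a `Y`-component. -/
theorem θA_wedgeY (F : W) : θ M .A (wedgeY M F) = wedgeY M (θ M .A F) := by
  refine lieDerivative_wedgeEnd (coord_odd rfl) (e_mem .A) (fun v => ?_) F
  change bracket (e .A) v .Y = 0
  simp [bracket_apply, e]

theorem θA_θA (F : W) : θ M .A (θ M .A F) = -θ M .X F := by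
  funext n
  refine Subtype.ext ?_
  have h := lieDer_lieDer (e_mem .A) (e_mem .A) (F n).1
  rw [show (br (e .A) (e .A) : Osp12) = (2 : ℝ) • e .X from bracket_e .A .A, lieDer_smul] at h
  have h' : (2 : ℝ) • lieDer M 1 (e .A) n (lieDer M 1 (e .A) n (F n))
      = (2 : ℝ) • -lieDer M 0 (e .X) n (F n) := by
    rw [two_smul, smul_neg]
    nth_rewrite 1 [show lieDer M 1 (e .A) n (lieDer M 1 (e .A) n (F n)) = _ from h]
    simp [Gen.parity, show (1 + 1 : ZMod 2) = 0 from rfl]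
    abel
  exact smul_right_injective _ two_ne_zero h'

/-! ### Vanishing in degrees at least three -/

/-- The cocycle equation on `(A, A, …)` recovers `i_X f` from `i_A f`. -/
theorem ιX_of_cocycle {f : W} (hf : δ M f = 0) (hA : ι M .A (ι M .A f) = 0) :
    ι M .X f = -θ M .A (ι M .A f) := by
  have h := congrArg (fun G => ι M .A (ι M .A G)) hf
  simp only [ι_δ, map_sub, ιA_θA, map_zero, hA] at h
  have h2 : (2 : ℂ) • (ι M .X f + θ M .A (ι M .A f)) = 0 := by
    linear_combination (norm := module) -h
  exact eq_neg_of_add_eq_zero_left ((smul_eq_zero.mp h2).resolve_left two_ne_zero)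

/-- The cocycle equation on `(B, B, …)` recovers `i_Y f` from `i_B f`. -/
theorem ιY_of_cocycle {f : W} (hf : δ M f = 0) (hB : ι M .B (ι M .B f) = 0) :
    ι M .Y f = θ M .B (ι M .B f) := by
  have h := congrArg (fun G => ι M .B (ι M .B G)) hf
  simp only [ι_δ, map_sub, ιB_θB, map_zero, hB] at h
  have h2 : (2 : ℂ) • (ι M .Y f - θ M .B (ι M .B f)) = 0 := by
    linear_combination (norm := module) h
  exact sub_eq_zero.mp ((smul_eq_zero.mp h2).resolve_left two_ne_zero)

/-- The cocycle equation on `(A, B, …)` recovers `i_H f` from `i_A f` and `i_B f`. -/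
theorem ιH_of_cocycle {f : W} (hf : δ M f = 0) (hAB : ι M .A (ι M .B f) = 0) :
    ι M .H f = -((1 / 2 : ℂ) • (θ M .A (ι M .B f) + θ M .B (ι M .A f))) := by
  have h := congrArg (fun G => ι M .A (ι M .B G)) hf
  simp only [ι_δ, map_sub, ιA_θB, map_zero, hAB] at h
  linear_combination (norm := module) (-1 / 2 : ℂ) • h

theorem eq_zero_of_three_smul {V : Type*} [AddCommGroup V] [Module ℂ V] {v : V}
    (h : v = -((2 : ℂ) • v)) : v = 0 := by
  have h3 : (3 : ℂ) • v = 0 := by linear_combination (norm := module) h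
  exact (smul_eq_zero.mp h3).resolve_left three_ne_zero

theorem ιX_ιA_of_cocycle {f : W} (hf : δ M f = 0) (hA : ι M .A (ι M .A f) = 0) :
    ι M .X (ι M .A f) = 0 := by
  have h := ι_ι_even' (t := .X) rfl .A f
  rw [ιX_of_cocycle hf hA, map_neg, ιA_θA, hA, map_zero, neg_zero, zero_sub, neg_neg] at h
  exact eq_zero_of_three_smul h

/-- On cochains killed by `i_A` and `i_X`, the Lie derivative `θ_X` is, modulo multiples of `Y*`,
the action of `X` on values, because `[X, s]` is a combination of `X` and `A` for every basis vector
`s ≠ Y`. So composition with a right inverse `T` of `X` is a right inverse of `θ_X` modulo `Y*`. -/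
theorem wedgeY_θX_postcomp {T : Module.End ℂ M} (hT : ∀ m, act (e .X) (T m) = m) {w : W}
    (hA : ι M .A w = 0) (hX : ι M .X w = 0) :
    wedgeY M (θ M .X (postcompEnd Osp12 T w)) = wedgeY M w := by
  rw [← sub_eq_zero, ← map_sub]
  set z : W → W := fun w => θ M .X (postcompEnd Osp12 T w) - w with hz
  have hpT : ∀ s w, ι M s (postcompEnd Osp12 T w) = postcompEnd Osp12 T (ι M s w) := fun _ _ => rfl
  have hιz : ∀ s, s ≠ .Y → ∀ w, ι M .A w = 0 → ι M .X w = 0 → ι M s (z w) = z (ι M s w) := by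
    intro s hs w hA hX
    simp only [hz]
    rw [map_sub, ι_θ_even (by simp [Gen.parity]), hpT]
    -- `[X, s]` lies in the span of `X` and `A` unless `s = Y`
    have : contraction M (brGen .X s) (postcompEnd Osp12 T w) = 0 := by
      cases s with
      | H => rw [brGen, contraction_neg, LinearMap.neg_apply, hpT, hX, map_zero, neg_zero]
      | X => rw [brGen, contraction_zero]; rfl
      | Y => exact absurd rfl hs
      | A => rw [brGen, contraction_zero]; rfl
      | B => rw [brGen, contraction_neg, LinearMap.neg_apply, hpT, hA, map_zero, neg_zero]
    rw [this, sub_zero]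
  -- Induction on the degree, for all `w` at once: insertions other than `Y` commute with `z` up
  -- to sign, and a cochain whose insertions other than `Y` vanish is a multiple of `Y*`.
  have key : ∀ n w, ι M .A w = 0 → ι M .X w = 0 → ∀ m ≤ n, wedgeY M (z w) m = 0 := by
    intro n
    induction n with
    | zero =>
      intro w _ _ m hm
      obtain rfl : m = 0 := by omega
      rfl
    | succ n ih =>
      intro w hA hX m hm
      have hs : ∀ s, s ≠ .Y → ∀ m ≤ n, ι M s (wedgeY M (z w)) m = 0 := by
        intro s hs m hm
        rw [ι_wedgeY hs, hιz s hs w hA hX, Pi.neg_apply, ih _ ?_ ?_ m hm, neg_zero]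
        · exact ι_ι_eq_zero hA
        · exact ι_ι_eq_zero hX
      match m with
      | 0 => rfl
      | 1 =>
        refine eq_zero_of_ι fun s => ?_
        by_cases h : s = .Y
        · subst h
          -- on `0`-cochains `θ_X` is the action of `X` on values, and `T` is its right inverse
          have h0 : z w 0 = 0 := by
            refine Subtype.ext (MultilinearMap.ext fun U => ?_)
            change act (e .X) (parityAut ℂ 0 (T ((w 0).1 U))) - (w 0).1 U = 0
            simp [parityAut, proj_zero_add_proj_one, hT]
          rw [ιY_wedgeY, Pi.sub_apply, h0]
          exact sub_zero _
        · exact hs s h 0 (by omega)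
      | m + 2 =>
        refine eq_zero_of_ι fun s => ?_
        by_cases h : s = .Y
        · subst h
          refine eq_zero_of_ι fun s => ?_
          by_cases h : s = .Y
          · subst h
            rw [ι_ι_self rfl]; rfl
          · rw [ι_ι_even rfl, Pi.neg_apply, neg_eq_zero]
            refine Subtype.ext ?_
            rw [contraction_coe, hs s h (m + 1) (by omega)]
            exact map_zero _
        · exact hs s h (m + 1) (by omega)
  funext n
  exact key n w hA hX n le_rfl

/-- A cocycle with `i_A² f = 0` can be corrected so that moreover `i_A f` is a multiple of `Y*`. The
correction `g = -θ_A T i_A f` works because `θ_A² = -θ_X`, so that `i_A f` changes into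
`i_A f - θ_X T i_A f`. -/
theorem exists_normal_A {T : Module.End ℂ M} (hT : ∀ m, act (e .X) (T m) = m) {f : W}
    {d : ℕ} (hd : f ∈ DegreeLE d) (hf : δ M f = 0) (hA : ι M .A (ι M .A f) = 0) :
    ∃ g, (f - δ M g ∈ DegreeLE d ∧ ι M .A (ι M .A (f - δ M g)) = 0) ∧
      wedgeY M (ι M .A (f - δ M g)) = 0 := by
  have hX := ιX_ιA_of_cocycle hf hA
  set w := postcompEnd Osp12 T (ι M .A f) with hw
  have hAw : ι M .A w = 0 := (congrArg (postcompEnd Osp12 T) hA).trans (map_zero _)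
  have hXw : ι M .X w = 0 := (congrArg (postcompEnd Osp12 T) hX).trans (map_zero _)
  have h : ι M .A (f - δ M (-θ M .A w)) = ι M .A f - θ M .X w := by
    rw [map_sub, ι_δ, map_neg, map_neg, θA_θA, ιA_θA, hAw, hXw]
    simp
  refine ⟨-θ M .A w, ⟨sub_mem hd fun n hn => ?_, ?_⟩, ?_⟩
  · cases n with
    | zero => rfl
    | succ n =>
      have h0 : w n = 0 := Subtype.ext (by
        change postcomp Osp12 T n (contract M (e .A) (f (n + 1))) = 0
        rw [hd _ hn]
        exact (congrArg _ (map_zero _)).trans (map_zero _))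
      refine Subtype.ext ?_
      rw [differential_succ, Pi.neg_apply]
      have h1 : θ M .A w n = 0 := Subtype.ext (by
        change lieDer M _ _ n (w n).1 = 0
        rw [h0]
        exact map_zero _)
      rw [h1, neg_zero]
      exact map_zero _
  · rw [h, map_sub, hA, ι_θ_even rfl, hAw, brGen, contraction_zero]
    simp
  · rw [h, map_sub, wedgeY_θX_postcomp hT hA hX, sub_self]

/-- The corrections that eliminate `i_B²` do not affect the normal form reached for `i_A f`. -/
theorem normal_preserved {f : W} (κ : ℂ) (hf : δ M f = 0)
    (h : ι M .A (ι M .A f) = 0 ∧ wedgeY M (ι M .A f) = 0) :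
    ι M .A (ι M .A (f - δ M (κ • wedgeY M ((ι M .B ^ 2) f)))) = 0 ∧
      wedgeY M (ι M .A (f - δ M (κ • wedgeY M ((ι M .B ^ 2) f)))) = 0 := by
  obtain ⟨hA, hY⟩ := h
  have hB : ∀ F : W, (ι M .B ^ 2) F = ι M .B (ι M .B F) := fun F => by rw [pow_two]; rfl
  set g := κ • wedgeY M ((ι M .B ^ 2) f) with hg
  have hBY : ∀ F : W, wedgeY M (ι M .B (ι M .B F)) = ι M .B (ι M .B (wedgeY M F)) := by
    intro F
    rw [ι_wedgeY (by decide), map_neg, ι_wedgeY (by decide), neg_neg]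
  have hAg : ι M .A g = 0 := by
    rw [hg, map_smul, hB, ι_wedgeY (by decide), ι_ι_odd rfl rfl, ι_ι_odd (s := .B) rfl rfl f, hBY,
      hY]
    simp
  have hXg : ι M .X g = 0 := by
    rw [hg, map_smul, hB, ι_wedgeY (by decide), ι_ι_even' (t := .X) rfl,
      ι_ι_even' (t := .X) rfl, map_neg, neg_neg,
      ιX_of_cocycle hf hA, map_neg, map_neg, map_neg, map_neg, map_neg, hBY, ← θA_wedgeY, hY]
    simp
  have hf' : ι M .A (f - δ M g) = ι M .A f - θ M .A g := by
    rw [map_sub, ι_δ, hAg, map_zero, sub_zero]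
  rw [hf']
  constructor
  · rw [map_sub, hA, ιA_θA, hAg, hXg]
    simp
  · rw [map_sub, hY, hg, map_smul, θA_wedgeY, map_smul, wedgeEnd_wedgeEnd]
    simp

/-- For a cocycle in normal form, `i_A f` and `i_B f` are multiples of `Y*` and `H*` of degree at
most `1`; the other insertions are determined by them. -/
theorem degreeLE_of_normal {f : W} (hf : δ M f = 0) (hA : ι M .A (ι M .A f) = 0)
    (hY : wedgeY M (ι M .A f) = 0) (hB : ι M .B (ι M .B f) = 0) : f ∈ DegreeLE 2 := by
  have hXf := ιX_of_cocycle hf hA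
  have hYf := ιY_of_cocycle hf hB
  have hXA := ιX_ιA_of_cocycle hf hA
  -- `i_B i_A f` is a multiple of `Y*` that is killed by `i_Y`
  have hBA : ι M .B (ι M .A f) = 0 := by
    have h1 : wedgeY M (ι M .B (ι M .A f)) = 0 := by
      have := ι_wedgeY (s := .B) (by decide) (ι M .A f)
      rw [hY, map_zero] at this
      exact neg_eq_zero.mp this.symm
    have hBBA : ι M .B (ι M .B (ι M .A f)) = 0 := by
      rw [ι_ι_odd (s := .A) (t := .B) rfl rfl, ι_ι_odd (s := .A) (t := .B) rfl rfl, hB, map_zero]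
    have h2 : ι M .Y (ι M .B (ι M .A f)) = -((2 : ℂ) • ι M .Y (ι M .B (ι M .A f))) := by
      have h3 : ι M .Y (ι M .B (ι M .A f)) = ι M .B (ι M .A (ι M .Y f)) := by
        rw [ι_ι_even' (t := .Y) rfl, ι_ι_even' (t := .Y) rfl, map_neg, neg_neg]
      nth_rewrite 1 [h3]
      rw [hYf, ιA_θB, map_sub, map_neg, ιB_θB, ι_ι_odd (s := .B) (t := .A) rfl rfl, hBBA, map_zero,
        map_smul, ι_ι_even (s := .H) rfl, hB, map_zero]
      simp
    have h4 := wedgeY_ιY h1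
    rw [eq_zero_of_three_smul h2, map_zero] at h4
    exact h4.symm
  have hAB : ι M .A (ι M .B f) = 0 := by rw [ι_ι_odd rfl rfl, hBA]
  -- `i_A f` is a multiple of `Y*`, so `i_H i_A f = -Y* ∧ i_H i_Y i_A f`, and `i_H ^ 2 = 0`
  have hYa : ι M .Y (ι M .A f) = (2 : ℂ) • ι M .H (ι M .B f) := by
    rw [ι_ι_even' (t := .Y) rfl, hYf, ιA_θB, hAB, map_zero]
    simp
  have hHa : ι M .H (ι M .A f) = 0 := by
    rw [← wedgeY_ιY hY, hYa, map_smul, map_smul, ι_wedgeY (by decide), ι_ι_self rfl]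
    simp
  -- the only insertion that does not kill `i_A f` is `i_Y`, and nothing survives after it
  have ha : ι M .A f ∈ DegreeLE 1 := by
    have h0 : ι M .Y (ι M .A f) ∈ DegreeLE 0 := by
      refine mem_degreeLE_zero_of_ι fun s => ?_
      cases s with
      | H => rw [ι_ι_even rfl, hHa, map_zero, neg_zero]
      | X => rw [ι_ι_even rfl, hXA, map_zero, neg_zero]
      | Y => rw [ι_ι_self rfl]
      | A => rw [ι_ι_even rfl, hA, map_zero, neg_zero]
      | B => rw [ι_ι_even rfl, hBA, map_zero, neg_zero]
    refine mem_degreeLE_of_ι fun s => ?_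
    cases s with
    | H => rw [hHa]; exact zero_mem _
    | X => rw [hXA]; exact zero_mem _
    | Y => exact h0
    | A => rw [hA]; exact zero_mem _
    | B => rw [hBA]; exact zero_mem _
  have hYb : ι M .Y (ι M .B f) = 0 := by
    refine eq_zero_of_three_smul ?_
    nth_rewrite 1 [ι_ι_even' (t := .Y) rfl]
    rw [hYf, ιB_θB, hB, map_zero, neg_zero, zero_add]
  have hXb : ι M .X (ι M .B f) = 0 := by
    rw [ι_ι_even' (t := .X) rfl, hXf, map_neg, ιB_θA, hBA, hHa]
    simp
  -- likewise for `i_B f`, with `i_H` in place of `i_Y`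
  have hb : ι M .B f ∈ DegreeLE 1 := by
    have h0 : ι M .H (ι M .B f) ∈ DegreeLE 0 := by
      refine mem_degreeLE_zero_of_ι fun s => ?_
      cases s with
      | H => rw [ι_ι_self rfl]
      | X => rw [ι_ι_even rfl, hXb, map_zero, neg_zero]
      | Y => rw [ι_ι_even rfl, hYb, map_zero, neg_zero]
      | A => rw [ι_ι_even rfl, hAB, map_zero, neg_zero]
      | B => rw [ι_ι_even rfl, hB, map_zero, neg_zero]
    refine mem_degreeLE_of_ι fun s => ?_
    cases s with
    | H => exact h0
    | X => rw [hXb]; exact zero_mem _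
    | Y => rw [hYb]; exact zero_mem _
    | A => rw [hAB]; exact zero_mem _
    | B => rw [hB]; exact zero_mem _
  refine mem_degreeLE_of_ι fun s => ?_
  cases s with
  | H =>
    rw [ιH_of_cocycle hf hAB]
    exact neg_mem (Submodule.smul_mem _ _ (add_mem (lieDerivative_mem_degreeLE _ hb)
      (lieDerivative_mem_degreeLE _ ha)))
  | X =>
    rw [hXf]
    exact neg_mem (lieDerivative_mem_degreeLE _ ha)
  | Y =>
    rw [hYf]
    exact lieDerivative_mem_degreeLE _ hb
  | A => exact ha
  | B => exact hb

/-- If `X` has a right inverse on `M`, every cocycle is cohomologous to one of degree at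
most `2`. -/
theorem exists_degreeLE_two {T : Module.End ℂ M} (hT : ∀ m, act (e .X) (T m) = m) {d : ℕ} {f : W}
    (hd : f ∈ DegreeLE d) (hf : δ M f = 0) : ∃ g, f - δ M g ∈ DegreeLE 2 := by
  have hpow : ∀ (s : Gen) (F : W), (ι M s ^ 2) F = ι M s (ι M s F) := fun s F => by
    rw [pow_two]; rfl
  have hδ : ∀ {f g : W}, δ M f = 0 → δ M (f - δ M g) = 0 := fun {f g} h => by
    rw [map_sub, h, differential_differential, sub_zero]
  have hvanish : ∀ (s : Gen) {F : W}, F ∈ DegreeLE d → (ι M s ^ (d + 2)) F = 0 := fun s F h => by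
    rw [pow_succ', Module.End.mul_apply, contraction_pow_eq_zero _ d h, map_zero]
  have even_odd : ∀ {s t : Gen}, s.parity = 0 → ι M t * ι M s = -(ι M s * ι M t) := fun h =>
    LinearMap.ext fun F => ι_ι_even h _ F
  obtain ⟨g₁, hA, hd₁⟩ := exists_elimination (c := 2) two_ne_zero (U := ι M .A) (D := δ M)
    (Θ := θ M .A) (X := ι M .X) (E := wedgeX M) (LinearMap.ext fun F => ι_δ _ F)
    (LinearMap.ext fun F => ιA_θA F) (even_odd rfl)
    (LinearMap.ext fun F => ιA_wedgeX F) (LinearMap.ext fun F => ιX_wedgeX F)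
    differential_differential (fun F => F ∈ DegreeLE d)
    (fun F κ _ hF => sub_mem hF (differential_wedgeEnd_mem_degreeLE _ _ κ hF)) d hf hd
    (hvanish _ hd)
  rw [hpow] at hA
  obtain ⟨g₂, ⟨hd₂, hA₂⟩, hY₂⟩ := exists_normal_A hT hd₁ (hδ hf) hA
  obtain ⟨g₃, hB, -, hA₃, hY₃⟩ := exists_elimination (c := -2) (neg_ne_zero.mpr two_ne_zero)
    (U := ι M .B) (D := δ M)
    (Θ := θ M .B) (X := ι M .Y) (E := wedgeY M) (LinearMap.ext fun F => ι_δ _ F)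
    (LinearMap.ext fun F => by
      refine (ιB_θB F).trans ?_
      simp)
    (even_odd rfl)
    (LinearMap.ext fun F => ι_wedgeY (by decide) F) (LinearMap.ext fun F => ιY_wedgeY F)
    differential_differential
    (fun F => F ∈ DegreeLE d ∧ ι M .A (ι M .A F) = 0 ∧ wedgeY M (ι M .A F) = 0)
    (fun F κ hF h => ⟨sub_mem h.1 (differential_wedgeEnd_mem_degreeLE _ _ κ h.1),
      normal_preserved κ hF h.2⟩) d (hδ (hδ hf)) ⟨hd₂, hA₂, hY₂⟩ (hvanish _ hd₂)
  rw [hpow] at hB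
  refine ⟨g₁ + g₂ + g₃, ?_⟩
  rw [map_add, map_add, ← sub_sub, ← sub_sub]
  exact degreeLE_of_normal (hδ (hδ (hδ hf))) hA₃ hY₃ hB

/-- A cocycle, viewed as a total cochain concentrated in its own degree. -/
theorem exists_total_cocycle {n : ℕ} {f : Mult Osp12 M n} (hf : f ∈ cocycles Osp12 M n) :
    ∃ F : W, (F n : Mult Osp12 M n) = f ∧ (∀ m, m ≠ n → F m = 0) ∧ δ M F = 0 := by
  refine ⟨Pi.single n ⟨f, hf.1⟩, by rw [Pi.single_eq_same], fun m hm => Pi.single_eq_of_ne hm _, ?_⟩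
  funext m
  refine Subtype.ext ?_
  cases m with
  | zero => rfl
  | succ m =>
    rw [differential_succ]
    by_cases h : m = n
    · subst h
      rw [Pi.single_eq_same]
      exact hf.2
    · rw [Pi.single_eq_of_ne h]
      exact map_zero _

theorem mem_coboundaries_of_sub_mem_degreeLE {n d : ℕ} {F g : W} (h : F - δ M g ∈ DegreeLE d)
    (hd : d < n + 1) : (F (n + 1) : Mult Osp12 M (n + 1)) ∈ coboundaries Osp12 M (n + 1) := by
  refine ⟨g n, (g n).2, ?_⟩
  have h := congrArg Subtype.val (h (n + 1) hd)
  exact (sub_eq_zero.mp h).symm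

/-- The cohomology of `osp(1|2)` with values in `M` vanishes in degrees `≥ 3`. -/
theorem mem_coboundaries_of_three_le
    (hA : Function.Surjective (act (e .A) : Module.End ℂ M)) {n : ℕ} (hn : 3 ≤ n + 1)
    {f : Mult Osp12 M (n + 1)} (hf : f ∈ cocycles Osp12 M (n + 1)) :
    f ∈ coboundaries Osp12 M (n + 1) := by
  have hX : ∀ m : M, act (e .X) m = act (e .A) (act (e .A) m) := by
    intro m
    have h := act_br (e_mem .A) (e_mem .A) m
    rw [show (br (e .A) (e .A) : Osp12) = (2 : ℝ) • e .X from bracket_e .A .A, map_smul] at h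
    have h2 : (2 : ℝ) • act (e .X) m = (2 : ℝ) • act (e .A) (act (e .A) m) := by
      refine h.trans ?_
      simp [Gen.parity, two_smul]
    exact smul_right_injective _ two_ne_zero h2
  obtain ⟨S, hS⟩ := LinearMap.exists_rightInverse_of_surjective _ (LinearMap.range_eq_top.mpr hA)
  have hS' : ∀ m, act (e .A) (S m) = m := LinearMap.congr_fun hS
  obtain ⟨F, rfl, hF, hδ⟩ := exists_total_cocycle hf
  have hd : F ∈ DegreeLE (n + 1) := fun m hm => hF m hm.ne'
  obtain ⟨g, hg⟩ := exists_degreeLE_two (T := S ∘ₗ S)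
    (fun m => by rw [hX, LinearMap.comp_apply, hS', hS']) hd hδ
  exact mem_coboundaries_of_sub_mem_degreeLE hg hn

/-! ### Primitives in degrees one and two -/

/-- The commutator of two Lie derivatives when the bracket of the basis vectors is a multiple of a
basis vector. -/
theorem θ_θ {s t r : Gen} {c : ℝ} (hr : s.parity + t.parity = r.parity)
    (hb : brGen s t = c • e r) (F : W) :
    θ M t (θ M s F) = (-1 : ℤˣ) ^ (s.parity * t.parity) • θ M s (θ M t F) - (c : ℂ) • θ M r F := by
  funext n
  refine Subtype.ext ?_
  have h := lieDer_lieDer (e_mem s) (e_mem t) (F n).1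
  rw [show (br (e s) (e t) : Osp12) = c • e r from (bracket_e s t).trans hb, lieDer_smul, hr] at h
  refine h.trans ?_
  rcases Int.units_eq_one_or ((-1 : ℤˣ) ^ (s.parity * t.parity)) with h1 | h1 <;> simp [h1] <;> rfl

theorem θH_eq (F : W) :
    θ M .H F = -((1 / 2 : ℂ) • (θ M .A (θ M .B F) + θ M .B (θ M .A F))) := by
  have h := θ_θ (M := M) (s := .A) (t := .B) (r := .H) (c := 2) rfl rfl F
  simp [Gen.parity] at h
  linear_combination (norm := module) (1 / 2 : ℂ) • h

theorem θX_eq (F : W) : θ M .X F = -θ M .A (θ M .A F) := by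
  rw [θA_θA, neg_neg]

theorem θY_eq (F : W) : θ M .Y F = θ M .B (θ M .B F) := by
  have h := θ_θ (M := M) (s := .B) (t := .B) (r := .Y) (c := -2) rfl (by simp [brGen]) F
  simp [Gen.parity] at h
  linear_combination (norm := module) (-1 / 2 : ℂ) • h

theorem θA_θA_θB (F : W) :
    θ M .A (θ M .A (θ M .B F)) - θ M .B (θ M .A (θ M .A F)) - θ M .A F = 0 := by
  have h := θ_θ (M := M) (s := .B) (t := .X) (r := .A) (c := 1) rfl (by simp [brGen]) F
  simp [Gen.parity, θX_eq] at h
  linear_combination (norm := module) -h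

theorem θB_θB_θA (F : W) :
    θ M .B (θ M .B (θ M .A F)) - θ M .A (θ M .B (θ M .B F)) + θ M .B F = 0 := by
  have h := θ_θ (M := M) (s := .A) (t := .Y) (r := .B) (c := 1) rfl (by simp [brGen]) F
  simp [Gen.parity, θY_eq] at h
  linear_combination (norm := module) h

/-- Rigidity: these vanishing conditions force a cocycle to vanish in positive degree. The remaining
insertions are expressed by `i_A F` and `i_B F` through the cocycle equation. -/
theorem degreeLE_zero_of_ι {F : W} (hF : δ M F = 0) (hAA : ι M .A (ι M .A F) = 0)
    (hAB : ι M .A (ι M .B F) = 0) (hBB : ι M .B (ι M .B F) = 0) (hHA : ι M .H (ι M .A F) = 0)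
    (hHB : ι M .H (ι M .B F) = 0) (ha0 : ι M .A F 0 = 0) (hb0 : ι M .B F 0 = 0) :
    F ∈ DegreeLE 0 := by
  have hBA : ι M .B (ι M .A F) = 0 := by rw [ι_ι_odd rfl rfl, hAB]
  have hXa := ιX_ιA_of_cocycle hF hAA
  have hXF := ιX_of_cocycle hF hAA
  have hYF := ιY_of_cocycle hF hBB
  have hYa : ι M .Y (ι M .A F) = 0 := by
    rw [ι_ι_even' (t := .Y) rfl, hYF, ιA_θB, hAB, hHB]
    simp
  have hYb : ι M .Y (ι M .B F) = 0 := by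
    refine eq_zero_of_three_smul ?_
    nth_rewrite 1 [ι_ι_even' (t := .Y) rfl]
    rw [hYF, ιB_θB, hBB, map_zero, neg_zero, zero_add]
  have hXb : ι M .X (ι M .B F) = 0 := by
    rw [ι_ι_even' (t := .X) rfl, hXF, map_neg, ιB_θA, hBA, hHA]
    simp
  have ha : ι M .A F = 0 := by
    funext n
    cases n with
    | zero => exact ha0
    | succ n =>
      exact eq_zero_of_ι fun s => by cases s <;> simp only [hHA, hXa, hYa, hAA, hBA] <;> rfl
  have hb : ι M .B F = 0 := by
    funext n
    cases n with
    | zero => exact hb0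
    | succ n =>
      exact eq_zero_of_ι fun s => by cases s <;> simp only [hHB, hXb, hYb, hAB, hBB] <;> rfl
  refine mem_degreeLE_zero_of_ι fun s => ?_
  cases s with
  | H => rw [ιH_of_cocycle hF hAB, ha, hb]; simp
  | X => rw [hXF, ha]; simp
  | Y => rw [hYF, hb]; simp
  | A => exact ha
  | B => exact hb

/-- A `1`-cochain with prescribed values on the basis. -/
theorem exists_degree_one {h : Gen → W} (hh : ∀ s, h s ∈ DegreeLE 0) :
    ∃ G : W, G 0 = 0 ∧ ∀ s, ι M s G = h s := by
  refine ⟨Pi.single 1 ⟨LinearMap.uncurryLeft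
    (∑ s, (coord s).smulRight (h s 0 : Mult Osp12 M 0)), mem_cochains_one _⟩,
    Pi.single_eq_of_ne (by omega) _, fun s => ?_⟩
  funext n
  refine Subtype.ext ?_
  rw [contraction_coe]
  cases n with
  | zero =>
    rw [Pi.single_eq_same, contract_uncurryLeft]
    simp [coord_e]
  | succ n =>
    rw [Pi.single_eq_of_ne (by omega), hh s _ (by omega)]
    exact map_zero _

theorem ι_mem_degreeLE {F : W} {d : ℕ} (h : F ∈ DegreeLE (d + 1)) (s : Gen) :
    ι M s F ∈ DegreeLE d := by
  intro n hn
  refine Subtype.ext ?_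
  rw [contraction_coe, h (n + 1) (by omega)]
  exact map_zero _

theorem ι_eq_zero_of_mem_degreeLE_zero {F : W} (h : F ∈ DegreeLE 0) (s : Gen) : ι M s F = 0 := by
  funext n
  refine Subtype.ext ?_
  rw [contraction_coe, h (n + 1) (by omega)]
  exact map_zero _

/-- A `1`-cocycle that vanishes on even vectors is the coboundary of `(A F(B) - B F(A)) / 2`, where
`A` and `B` act through `θ`. -/
theorem exists_primitive_one {F : W} (hF : δ M F = 0) (hd : F ∈ DegreeLE 1) (hH : ι M .H F = 0)
    (hX : ι M .X F = 0) (hY : ι M .Y F = 0) : ∃ G, F - δ M G ∈ DegreeLE 0 := by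
  have h1 := ι_mem_degreeLE hd
  -- `F` is concentrated in degrees `≤ 1`, so two insertions kill it
  have h2 : ∀ s t, ι M t (ι M s F) = 0 := fun s t => ι_eq_zero_of_mem_degreeLE_zero (h1 s) t
  have hG : (1 / 2 : ℂ) • (θ M .A (ι M .B F) - θ M .B (ι M .A F)) ∈ DegreeLE 0 :=
    Submodule.smul_mem _ _ (sub_mem (lieDerivative_mem_degreeLE _ (h1 _))
      (lieDerivative_mem_degreeLE _ (h1 _)))
  have hιG := ι_eq_zero_of_mem_degreeLE_zero hG
  have e1 : θ M .A (ι M .A F) = 0 := by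
    rw [← neg_eq_zero, ← ιX_of_cocycle hF (h2 _ _), hX]
  have e2 : θ M .B (ι M .B F) = 0 := by
    rw [← ιY_of_cocycle hF (h2 _ _), hY]
  -- values of the cocycle equation on the pairs `(B, X)`, `(A, H)`, `(A, Y)`, `(B, H)`
  have e3 := congrArg (fun K => ι M .X (ι M .B K)) hF
  have e4 := congrArg (fun K => ι M .H (ι M .A K)) hF
  have e5 := congrArg (fun K => ι M .Y (ι M .A K)) hF
  have e6 := congrArg (fun K => ι M .H (ι M .B K)) hF
  simp only [ι_δ, map_sub, ιX_θB, ιH_θA, ιY_θA, ιH_θB, hX, hY, hH, h2, map_zero, θH_eq, θX_eq,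
    θY_eq, e1, e2] at e3 e4 e5 e6
  have hA : ι M .A (F - δ M ((1 / 2 : ℂ) • (θ M .A (ι M .B F) - θ M .B (ι M .A F)))) = 0 := by
    rw [map_sub, ι_δ, hιG, map_zero, sub_zero, map_smul, map_sub]
    linear_combination (norm := module) (-1 / 2 : ℂ) • e3 + e4
  have hB : ι M .B (F - δ M ((1 / 2 : ℂ) • (θ M .A (ι M .B F) - θ M .B (ι M .A F)))) = 0 := by
    rw [map_sub, ι_δ, hιG, map_zero, sub_zero, map_smul, map_sub]
    linear_combination (norm := module) (-1 / 2 : ℂ) • e5 - e6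
  refine ⟨_, degreeLE_zero_of_ι ?_ ?_ ?_ ?_ ?_ ?_ (congrFun hA 0) (congrFun hB 0)⟩
  · rw [map_sub, hF, differential_differential, sub_zero]
  all_goals simp only [hA, hB, map_zero]

/-- A `2`-cocycle that vanishes on pairs of even vectors is a coboundary. The check on the pairs
`(A, H)` and `(B, H)` is a linear combination of cocycle equations and of the relations
`[X, B] = -A` and `[Y, A] = -B`, with `H`, `X`, `Y` expressed by `A` and `B`. -/
theorem exists_primitive_two {F : W} (hF : δ M F = 0) (hd : F ∈ DegreeLE 2) (h1 : F 1 = 0)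
    (hHX : ι M .H (ι M .X F) = 0) (hHY : ι M .H (ι M .Y F) = 0) (hXY : ι M .X (ι M .Y F) = 0) :
    ∃ G, F - δ M G ∈ DegreeLE 0 := by
  have hι : ∀ s t, ι M t (ι M s F) ∈ DegreeLE 0 := fun s t =>
    ι_mem_degreeLE (ι_mem_degreeLE hd s) t
  have hθ : ∀ s, ∀ K ∈ DegreeLE 0, θ M s K ∈ DegreeLE 0 := fun s K hK =>
    lieDerivative_mem_degreeLE _ hK
  have h3 : ∀ r s t, ι M r (ι M s (ι M t F)) = 0 := fun r s t =>
    ι_eq_zero_of_mem_degreeLE_zero (hι t s) r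
  have hYX : ι M .Y (ι M .X F) = 0 := by rw [ι_ι_even rfl, hXY, neg_zero]
  have hHH := ι_ι_self (s := .H) rfl F
  have sBA := ι_ι_odd (s := .A) (t := .B) rfl rfl F
  have sAY := ι_ι_even (s := .Y) rfl .A F
  have sBX := ι_ι_even (s := .X) rfl .B F
  -- values of the cocycle equation on triples of basis vectors
  have e1 := congrArg (fun K => ι M .H (ι M .A (ι M .A K))) hF
  have e3 := congrArg (fun K => ι M .Y (ι M .A (ι M .A K))) hF
  have e4 := congrArg (fun K => ι M .H (ι M .A (ι M .B K))) hF
  have e7 := congrArg (fun K => ι M .H (ι M .B (ι M .B K))) hF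
  have e8 := congrArg (fun K => ι M .X (ι M .B (ι M .B K))) hF
  have e11 := congrArg (fun K => ι M .B (ι M .A (ι M .A K))) hF
  have e12 := congrArg (fun K => ι M .A (ι M .B (ι M .B K))) hF
  simp only [ι_δ, map_sub, map_add, map_neg, map_smul, ιA_θA, ιB_θA, ιH_θA, ιY_θA, ιA_θB,
    ιB_θB, ιX_θB, ιH_θB, h3, hHX, hHY, hXY, hYX, hHH, sBA, sAY, sBX, map_zero, θH_eq, θX_eq,
    θY_eq] at e1 e3 e4 e7 e8 e11 e12
  -- `P` and `Q` are the values of the primitive `G` on `A` and `B`; they are chosen so that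
  -- `F - ∂ G` vanishes on `(A, H)` and `(B, H)`, and are kept opaque until these two checks
  obtain ⟨P, hP⟩ : ∃ P, P = (1 / 2 : ℂ) • θ M .B (ι M .A (ι M .A F))
    + (2 : ℂ) • ι M .H (ι M .A F) + θ M .A (ι M .A (ι M .B F)) := ⟨_, rfl⟩
  obtain ⟨Q, hQ⟩ : ∃ Q, Q = -((1 / 2 : ℂ) • θ M .A (ι M .B (ι M .B F)))
    - (2 : ℂ) • ι M .H (ι M .B F) := ⟨_, rfl⟩
  have hP0 : P ∈ DegreeLE 0 := by
    rw [hP]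
    exact add_mem (add_mem (Submodule.smul_mem _ _ (hθ _ _ (hι _ _)))
      (Submodule.smul_mem _ _ (hι _ _))) (hθ _ _ (hι _ _))
  have hQ0 : Q ∈ DegreeLE 0 := by
    rw [hQ]
    exact sub_mem (neg_mem (Submodule.smul_mem _ _ (hθ _ _ (hι _ _))))
      (Submodule.smul_mem _ _ (hι _ _))
  -- the even values of `G` are dictated by `F = ∂ G` on the pairs `(A, A)`, `(A, B)`, `(B, B)`
  obtain ⟨G, hG0, hG⟩ := exists_degree_one (M := M) (h := fun
    | .A => P
    | .B => Q
    | .X => -((1 / 2 : ℂ) • ι M .A (ι M .A F)) - θ M .A P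
    | .H => -((1 / 2 : ℂ) • (ι M .A (ι M .B F) + (θ M .B P + θ M .A Q)))
    | .Y => (1 / 2 : ℂ) • ι M .B (ι M .B F) + θ M .B Q) (by
      intro s
      cases s with
      | A => exact hP0
      | B => exact hQ0
      | X => exact sub_mem (neg_mem (Submodule.smul_mem _ _ (hι _ _))) (hθ _ _ hP0)
      | H => exact neg_mem (Submodule.smul_mem _ _
          (add_mem (hι _ _) (add_mem (hθ _ _ hP0) (hθ _ _ hQ0))))
      | Y => exact add_mem (Submodule.smul_mem _ _ (hι _ _)) (hθ _ _ hQ0))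
  have hGA := hG .A
  have hGB := hG .B
  have hGX := hG .X
  have hGH := hG .H
  have hGY := hG .Y
  have hιP := ι_eq_zero_of_mem_degreeLE_zero hP0
  have hιQ := ι_eq_zero_of_mem_degreeLE_zero hQ0
  have hF1 : (F - δ M G) 1 = 0 := by
    refine Subtype.ext ?_
    rw [Pi.sub_apply, h1]
    change (0 : Mult Osp12 M 1) - coboundary Osp12 M 0 (G 0) = 0
    rw [hG0, zero_sub, neg_eq_zero]
    exact map_zero _
  refine ⟨G, degreeLE_zero_of_ι ?_ ?_ ?_ ?_ ?_ ?_ ?_ ?_⟩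
  · rw [map_sub, hF, differential_differential, sub_zero]
  · simp only [map_sub, ι_δ, ιA_θA, hGA, hGX, hιP, map_zero]
    module
  · simp only [map_sub, ι_δ, ιA_θB, hGA, hGB, hGH, hιQ, map_zero]
    module
  · simp only [map_sub, ι_δ, ιB_θB, hGB, hGY, hιQ, map_zero]
    module
  · have rA := θA_θA_θB (ι M .A (ι M .B F))
    have rB := θB_θB_θA (ι M .A (ι M .A F))
    have e1' := congrArg (fun K => θ M .B K) e1
    have e4' := congrArg (fun K => θ M .A K) e4
    have e8' := congrArg (fun K => θ M .A K) e8
    have e11' := congrArg (fun K => θ M .A (θ M .B K)) e11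
    simp only [map_add, map_sub, map_neg, map_smul, map_zero] at e1' e4' e8' e11'
    simp only [map_sub, ι_δ, ιH_θA, hGA, hGH, hιP, map_zero, θH_eq, map_add, map_neg, map_smul]
    simp only [hP, hQ, map_add, map_sub, map_neg, map_smul]
    linear_combination (norm := module) (1 / 2 : ℂ) • e1' + e4' + (1 / 4 : ℂ) • e8'
      + (1 / 4 : ℂ) • e11' + (1 / 4 : ℂ) • rB + (1 / 2 : ℂ) • rA
  · have rA := θA_θA_θB (ι M .B (ι M .B F))
    have e3' := congrArg (fun K => θ M .B K) e3
    have e12' := congrArg (fun K => θ M .B (θ M .A K)) e12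
    have e7' := congrArg (fun K => θ M .A K) e7
    have e4' := congrArg (fun K => θ M .B K) e4
    simp only [map_add, map_sub, map_neg, map_smul, map_zero] at e3' e12' e7' e4'
    simp only [map_sub, ι_δ, ιH_θB, hGB, hGH, hιQ, map_zero, θH_eq, map_add, map_neg, map_smul]
    simp only [hP, hQ, map_add, map_sub, map_neg, map_smul]
    linear_combination (norm := module) (1 / 4 : ℂ) • e3' - (1 / 4 : ℂ) • e12' - (1 / 2 : ℂ) • e7'
      - e4' - (1 / 4 : ℂ) • rA
  · refine Subtype.ext ?_
    rw [contraction_coe, hF1]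
    exact map_zero _
  · refine Subtype.ext ?_
    rw [contraction_coe, hF1]
    exact map_zero _

/-! ### Reduction to cocycles that vanish on `sl(2)` -/

variable (M) in
/-- The extension of a multilinear map on `sl(2)` to `osp(1|2)` by zero on odd arguments. -/
def extend (n : ℕ) : Mult Sl2 M n →ₗ[ℂ] Mult Osp12 M n where
  toFun h := h.compLinearMap fun _ =>
    (proj ℝ 0 : Osp12 →ₗ[ℝ] Osp12).codRestrict (gr ℝ 0) (proj_mem ℝ 0)
  map_add' _ _ := rfl
  map_smul' _ _ := rfl

theorem extend_mem_cochains {n : ℕ} {h : Mult Sl2 M n} (hh : h ∈ cochains Sl2 M n) :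
    extend M n h ∈ cochains Osp12 M n := by
  have key : ∀ (p : ZMod 2) (u : Osp12), u ∈ gr ℝ p →
      ((proj ℝ 0 : Osp12 →ₗ[ℝ] Osp12).codRestrict (gr ℝ 0) (proj_mem ℝ 0) u : Sl2) ∈ gr ℝ p := by
    intro p u hu
    change proj ℝ 0 u ∈ gr ℝ p
    obtain rfl | rfl := parity_cases p
    · exact proj_mem ℝ 0 u
    · rw [proj_of_mem_of_ne ℝ (show (0 : ZMod 2) ≠ 1 by decide) hu]
      exact zero_mem _
  intro i j hij p q U hi hj
  exact hh i j hij p q _ (key p _ hi) (key q _ hj)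

theorem restrict_extend {n : ℕ} (h : Mult Sl2 M n) : restrict Osp12 M n (extend M n h) = h := by
  ext U
  change h (fun k => _) = h U
  congr 1
  funext k
  exact Subtype.ext (proj_of_mem ℝ (U k).2)

theorem eq_zero_of_mem_degreeLE {F : W} {d : ℕ} (h : F ∈ DegreeLE d)
    (h' : ∀ m ≤ d, (F m : Mult Osp12 M m) = 0) : F = 0 := by
  funext m
  obtain hm | hm := le_or_gt m d
  · exact Subtype.ext (h' m hm)
  · exact h m hm

theorem mem_coboundaries_of_restrict_eq_zero
    (hA : Function.Surjective (act (e .A) : Module.End ℂ M)) {n : ℕ}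
    {f : Mult Osp12 M (n + 1)} (hf : f ∈ cocycles Osp12 M (n + 1))
    (h0 : restrict Osp12 M (n + 1) f = 0) : f ∈ coboundaries Osp12 M (n + 1) := by
  obtain ⟨F, rfl, hF, hδ⟩ := exists_total_cocycle hf
  have hd : F ∈ DegreeLE (n + 1) := fun m hm => hF m hm.ne'
  match n with
  | 0 =>
    have key : ∀ {s : Gen}, s.parity = 0 → ι M s F = 0 := by
      intro s hs
      refine eq_zero_of_mem_degreeLE (ι_mem_degreeLE hd s) fun m hm => ?_
      obtain rfl : m = 0 := by omega
      refine MultilinearMap.ext fun U => ?_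
      have h := congrArg (fun k : Mult Sl2 M 1 => k fun _ => ⟨e s, hs ▸ e_mem s⟩) h0
      rw [contraction_coe, contract_apply]
      refine Eq.trans (congrArg _ (funext fun k => ?_)) h
      fin_cases k
      rfl
    obtain ⟨G, hG⟩ := exists_primitive_one hδ hd (key rfl) (key rfl) (key rfl)
    exact mem_coboundaries_of_sub_mem_degreeLE hG one_pos
  | 1 =>
    have key : ∀ {s t : Gen}, s.parity = 0 → t.parity = 0 → ι M s (ι M t F) = 0 := by
      intro s t hs ht
      refine eq_zero_of_mem_degreeLE (ι_mem_degreeLE (ι_mem_degreeLE hd t) s) fun m hm => ?_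
      obtain rfl : m = 0 := by omega
      refine MultilinearMap.ext fun U => ?_
      have h := congrArg (fun k : Mult Sl2 M 2 => k ![⟨e t, ht ▸ e_mem t⟩, ⟨e s, hs ▸ e_mem s⟩]) h0
      rw [contraction_coe, contract_apply, contraction_coe, contract_apply]
      refine Eq.trans (congrArg _ (funext fun k => ?_)) h
      fin_cases k <;> rfl
    obtain ⟨G, hG⟩ := exists_primitive_two hδ hd (hF 1 (by omega)) (key rfl rfl) (key rfl rfl)
      (key rfl rfl)
    exact mem_coboundaries_of_sub_mem_degreeLE hG two_pos
  | n + 2 => exact mem_coboundaries_of_three_le hA (by omega) hf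

theorem mem_coboundaries_of_restrict
    (hA : Function.Surjective (act (e .A) : Module.End ℂ M)) {n : ℕ}
    {f : Mult Osp12 M n} (hf : f ∈ cocycles Osp12 M n)
    (h : restrict Osp12 M n f ∈ coboundaries Sl2 M n) : f ∈ coboundaries Osp12 M n := by
  cases n with
  | zero =>
    have h0 : restrict Osp12 M 0 f = 0 := h
    refine (Submodule.mem_bot ℂ).mpr (MultilinearMap.ext fun U => ?_)
    have h1 := congrArg (fun k : Mult Sl2 M 0 => k Fin.elim0) h0
    rw [Subsingleton.elim U fun k => ((Fin.elim0 k : Sl2) : Osp12)]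
    exact h1
  | succ n =>
    obtain ⟨k, hk, hkf⟩ := h
    have hk' := extend_mem_cochains hk
    have hb : coboundary Osp12 M n (extend M n k) ∈ coboundaries Osp12 M (n + 1) := ⟨_, hk', rfl⟩
    -- after this correction the cocycle restricts to zero
    have hfb : f - coboundary Osp12 M n (extend M n k) ∈ cocycles Osp12 M (n + 1) :=
      sub_mem hf ⟨coboundary_mem_cochains hk', coboundary_coboundary hk'⟩
    have := mem_coboundaries_of_restrict_eq_zero hA hfb (by
      rw [map_sub, ← coboundary_restrict, restrict_extend, sub_eq_zero]
      exact hkf.symm)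
    simpa using add_mem this hb

end Osp12

end SuperCoh

end

theorem mainTheorem2 {M : Type*} [AddCommGroup M] [Module ℂ M] [SuperCoh.Superspace ℂ M]
    [SuperCoh.LieSupermodule SuperCoh.Osp12 M]
    (hH : DirectSum.IsInternal fun α : ℂ =>
      Module.End.eigenspace
        (SuperCoh.LieSupermodule.act (SuperCoh.Osp12.e .H) : Module.End ℂ M) α)
    (hA : Function.Surjective
      (SuperCoh.LieSupermodule.act (SuperCoh.Osp12.e .A) : Module.End ℂ M))
    (n : ℕ) :
    (∀ f ∈ SuperCoh.cocycles SuperCoh.Osp12 M n,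
      f ∈ SuperCoh.coboundaries SuperCoh.Osp12 M n ↔
        SuperCoh.restrict SuperCoh.Osp12 M n f ∈ SuperCoh.coboundaries SuperCoh.Sl2 M n) ∧
    Function.Injective (SuperCoh.restrictCohomology SuperCoh.Osp12 M n) := by
  have key : ∀ f ∈ SuperCoh.cocycles SuperCoh.Osp12 M n,
      SuperCoh.restrict SuperCoh.Osp12 M n f ∈ SuperCoh.coboundaries SuperCoh.Sl2 M n →
        f ∈ SuperCoh.coboundaries SuperCoh.Osp12 M n :=
    fun f hf h => SuperCoh.Osp12.mem_coboundaries_of_restrict hA hf h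
  refine ⟨fun f hf => ⟨SuperCoh.restrict_mem_coboundaries, key f hf⟩, ?_⟩
  rw [injective_iff_map_eq_zero]
  intro x hx
  obtain ⟨f, rfl⟩ := Submodule.Quotient.mk_surjective _ x
  refine (Submodule.Quotient.mk_eq_zero _).mpr (key f f.2 ?_)
  exact (Submodule.Quotient.mk_eq_zero
    ((SuperCoh.coboundaries SuperCoh.Sl2 M n).submoduleOf _)).mp hx
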